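/- Let $d\ge 0$ be an integer, $\mu\in\mathbf R^d$, $\sigma>0$, and let $y\sim\mathcal N(\mu,\sigma^2 I_d)$. Let $B$ be a finite-dimensional real vector space, $\mathcal A:B\to\mathbf R^d$ a linear map, and $r:B\to\mathbf R\cup\{\infty\}$ a proper convex function such that for every $z\in\mathbf R^d$ the function $b\mapsto\frac12\|\mathcal A b-z\|_2^2+r(b)$ attains its minimum over $B$. Let $\hat\mu:\mathbf R^d\to\mathbf R^d$ be the convex regularized regression estimator $$\hat\mu(z)=\mathcal A\,\operatorname*{argmin}_{b\in B}\Big(\tfrac12\|\mathcal A b-z\|_2^2+r(b)\Big)$$ (the image under $\mathcal A$ of any minimizer). Write $D\hat\mu$ for its derivative, $\nabla\!\cdot\hat\mu=\operatorname{Tr}(D\hat\mu)=\sum_{i=1}^d\partial\hat\mu_i/\partial y_i$ for its divergence, $R(\hat\mu)=\mathbf E\|\hat\mu(y)-\mu\|_2^2$ for its risk, and $$\mathrm{SURE}(\hat\mu,y)=-d\sigma^2+\|\hat\mu(y)-y\|_2^2+2\sigma^2\,\nabla\!\cdot\hat\mu(y).$$ Then almost surely $\hat\mu$ is differentiable at $y$,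 $D\hat\mu(y)$ is symmetric positive semidefinite, and hence $\nabla\!\cdot\hat\mu(y)\ge 0$. The risk $R(\hat\mu)$, the expectation $\mathbf E[\nabla\!\cdot\hat\mu(y)]$ and the second moment of $\mathrm{SURE}(\hat\mu,y)$ are finite, and $$\operatorname{var}(\mathrm{SURE}(\hat\mu,y))\le 3\sigma^4 d-4\sigma^4\,\mathbf E[\nabla\!\cdot\hat\mu(y)]+4\sigma^2R(\hat\mu),$$ and consequently $$\operatorname{var}(\mathrm{SURE}(\hat\mu,y))\le 3\sigma^4 d+4\sigma^2R(\hat\mu).$$ -/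

import Mathlib

open MeasureTheory ProbabilityTheory

noncomputable section

namespace SureCR

/-- A proper convex function `r : B → ℝ ∪ {∞}`: it never takes the value `-∞`, it is finite
somewhere, and its epigraph is convex. -/
structure IsProperConvex {B : Type*} [AddCommGroup B] [Module ℝ B] (r : B → EReal) : Prop where
  ne_bot : ∀ b, r b ≠ ⊥
  exists_ne_top : ∃ b, r b ≠ ⊤
  convex_epigraph : Convex ℝ {q : B × ℝ | r q.1 ≤ (q.2 : EReal)}

/-- The objective `(1/2) ‖A b - y‖² + r b` of regularized least squares. -/
def objective {d : ℕ} {B : Type*} [AddCommGroup B] [Module ℝ B]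
    (A : B →ₗ[ℝ] EuclideanSpace ℝ (Fin d)) (r : B → EReal)
    (y : EuclideanSpace ℝ (Fin d)) (b : B) : EReal :=
  ((1 / 2 * ‖A b - y‖ ^ 2 : ℝ) : EReal) + r b

/-- `muHat y = A b` for some minimizer `b` of the objective with data `y`, for every `y`.
(All minimizers have the same image under `A` when `r` is proper and convex.) -/
def IsRegularizedRegression {d : ℕ} {B : Type*} [AddCommGroup B] [Module ℝ B]
    (A : B →ₗ[ℝ] EuclideanSpace ℝ (Fin d)) (r : B → EReal)
    (muHat : EuclideanSpace ℝ (Fin d) → EuclideanSpace ℝ (Fin d)) : Prop :=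
  ∀ y, ∃ b, (∀ b', objective A r y b ≤ objective A r y b') ∧ muHat y = A b

/-- The divergence `∑ i, ∂ muHat_i / ∂ y_i`, i.e. the trace of the derivative. -/
def divergence {d : ℕ} (muHat : EuclideanSpace ℝ (Fin d) → EuclideanSpace ℝ (Fin d))
    (y : EuclideanSpace ℝ (Fin d)) : ℝ :=
  ∑ i, (fderiv ℝ muHat y (EuclideanSpace.single i 1)) i

/-- Stein's unbiased risk estimate for observations with noise covariance `σ² I`. -/
def sure {d : ℕ} (σ : ℝ) (muHat : EuclideanSpace ℝ (Fin d) → EuclideanSpace ℝ (Fin d))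
    (y : EuclideanSpace ℝ (Fin d)) : ℝ :=
  -(d : ℝ) * σ ^ 2 + ‖muHat y - y‖ ^ 2 + 2 * σ ^ 2 * divergence muHat y

/-- The `ℓ²` risk `E ‖muHat y - μ‖²` for a random observation `y`. -/
def risk {d : ℕ} {Ω : Type*} [MeasurableSpace Ω] (P : Measure Ω)
    (y : Ω → EuclideanSpace ℝ (Fin d)) (μ : EuclideanSpace ℝ (Fin d))
    (muHat : EuclideanSpace ℝ (Fin d) → EuclideanSpace ℝ (Fin d)) : ℝ :=
  ∫ ω, ‖muHat (y ω) - μ‖ ^ 2 ∂P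

end SureCR

end

/-! The estimator is a proximal map: the residual `y - muHat y` is a subgradient at the fitted
value. It is therefore firmly nonexpansive, hence 1-Lipschitz and almost everywhere differentiable,
and it is a gradient field. So its derivative J is symmetric with J² ≤ J.

Rescale to σ = 1, μ = 0 and let v be the rescaled estimator. Then SURE equals ‖v‖² + 2 δh with h =
x/2 - v, where δh = ⟪x, h⟫ - div h is the adjoint of the gradient in Gaussian L². In the variance of
u + 2 δh with u = ‖v‖², the Gaussian Poincaré inequality bounds Var u, duality gives the cross term
E[u δh] = E⟪∇u, h⟫, and the second order Stein identity gives E(δh)² = E‖h‖² + E tr((Dh)²). The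
resulting bound contains only first derivatives, so it passes from smooth compactly supported fields
to Lipschitz ones (`variance_steinFunction_le`).

Inserting symmetry and J² ≤ J bounds the integrand pointwise by 2‖x‖² - 4⟪x, v⟫ + 4‖v‖² + d
(`varianceFunction_steinField_le`). By Stein's identity its mean is 3d - 4 E[div v] + 4 E‖v‖².
Undoing the scaling multiplies the variance by σ⁴ and the risk by σ², and leaves the divergence
unchanged. -/

namespace SureCR

open scoped RealInnerProductSpace Topology

/-! ### Proximal maps: firm nonexpansiveness and symmetry of the derivative. -/

section Prox

variable {E : Type*} [NormedAddCommGroup E] [InnerProductSpace ℝ E]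

/-- `p` is the proximal map of a convex function whose value at `p y` is `ρ y`: the residual
`y - p y` is a subgradient at `p y`, tested against the other points of the range of `p`. -/
def IsProxWith (p : E → E) (ρ : E → ℝ) : Prop :=
  ∀ y y', ⟪y - p y, p y' - p y⟫ ≤ ρ y' - ρ y

/-- Adding the subgradient inequalities at `x` and at `y` cancels `ρ`. -/
lemma IsProxWith.norm_sq_le {p : E → E} {ρ : E → ℝ} (h : IsProxWith p ρ) (x y : E) :
    ‖p x - p y‖ ^ 2 ≤ ⟪p x - p y, x - y⟫ := by
  have h1 := h x y
  have h2 := h y x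
  rw [← real_inner_self_eq_norm_sq]
  simp only [inner_sub_left, inner_sub_right] at *
  have e1 := real_inner_comm x (p x)
  have e2 := real_inner_comm x (p y)
  have e3 := real_inner_comm y (p x)
  have e4 := real_inner_comm y (p y)
  linarith

lemma IsProxWith.lipschitzWith {p : E → E} {ρ : E → ℝ} (h : IsProxWith p ρ) :
    LipschitzWith 1 p := by
  refine LipschitzWith.of_dist_le_mul fun x y => ?_
  rw [dist_eq_norm, dist_eq_norm, NNReal.coe_one, one_mul]
  have h1 := h.norm_sq_le x y
  have h2 := real_inner_le_norm (p x - p y) (x - y)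
  by_contra! hlt
  nlinarith [norm_nonneg (x - y), norm_nonneg (p x - p y)]

/-- The proximal map is the gradient of the conjugate of the Moreau envelope. -/
lemma IsProxWith.hasFDerivAt_potential {p : E → E} {ρ : E → ℝ} (h : IsProxWith p ρ) (y : E) :
    HasFDerivAt (fun y => ⟪y, p y⟫ - 1 / 2 * ‖p y‖ ^ 2 - ρ y) (innerSL ℝ (p y)) y := by
  -- `p a` competes in the problem with data `b`. This makes `p a` a subgradient of the potential at
  -- `a`.
  have lower : ∀ a b : E, ⟪b - a, p a⟫ ≤
      (⟪b, p b⟫ - 1 / 2 * ‖p b‖ ^ 2 - ρ b) - (⟪a, p a⟫ - 1 / 2 * ‖p a‖ ^ 2 - ρ a) := by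
    intro a b
    have h1 := h b a
    have h2 : 0 ≤ ‖p a - p b‖ ^ 2 := by positivity
    rw [← real_inner_self_eq_norm_sq] at *
    rw [← real_inner_self_eq_norm_sq]
    simp only [inner_sub_left, inner_sub_right] at *
    have e1 := real_inner_comm (p a) (p b)
    linarith
  refine HasFDerivAt.of_isLittleO ?_
  -- The subgradient inequalities at both endpoints squeeze the remainder between 0 and ⟪p x - p y,
  -- x - y⟫ ≤ ‖x - y‖².
  have hO : (fun x' : E => (⟪x', p x'⟫ - 1 / 2 * ‖p x'‖ ^ 2 - ρ x')
      - (⟪y, p y⟫ - 1 / 2 * ‖p y‖ ^ 2 - ρ y) - innerSL ℝ (p y) (x' - y))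
      =O[𝓝 y] fun x' => ‖x' - y‖ ^ 2 := by
    refine Asymptotics.IsBigO.of_bound 1 (Filter.Eventually.of_forall fun x => ?_)
    have h1 := lower y x
    have h2 := lower x y
    have h3 := real_inner_le_norm (p x - p y) (x - y)
    have h4 : ‖p x - p y‖ ≤ ‖x - y‖ := by
      simpa [dist_eq_norm] using h.lipschitzWith.dist_le_mul x y
    have h5 : ⟪p x - p y, x - y⟫ ≤ ‖x - y‖ ^ 2 := by
      nlinarith [norm_nonneg (x - y)]
    have e1 : ⟪y - x, p x⟫ = - ⟪p x, x - y⟫ := by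
      rw [real_inner_comm, ← inner_neg_right, neg_sub]
    have e2 : ⟪x - y, p y⟫ = ⟪p y, x - y⟫ := real_inner_comm _ _
    rw [inner_sub_left] at h5
    rw [innerSL_apply_apply, one_mul, Real.norm_eq_abs, norm_pow, norm_norm, abs_le]
    constructor <;> [nlinarith [sq_nonneg ‖x - y‖]; linarith]
  refine hO.trans_isLittleO ?_
  have : (fun x' => ‖x' - y‖ ^ 2) =o[𝓝 y] fun x' => ‖x' - y‖ :=
    (Asymptotics.isLittleO_pow_id one_lt_two).comp_tendsto (tendsto_norm_sub_self y)
  exact this.norm_right.of_norm_right.congr_right (fun _ => rfl) |>.of_norm_right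

/-- Firm nonexpansiveness passes to difference quotients. Together with symmetry this is J² ≤ J. -/
lemma IsProxWith.fderiv_norm_sq_le {p : E → E} {ρ : E → ℝ} (h : IsProxWith p ρ) {y : E}
    (hd : DifferentiableAt ℝ p y) (a : E) :
    ‖fderiv ℝ p y a‖ ^ 2 ≤ ⟪fderiv ℝ p y a, a⟫ := by
  have hl : Filter.Tendsto (fun t : ℝ => t⁻¹ • (p (y + t • a) - p y)) (𝓝[≠] 0)
      (𝓝 (fderiv ℝ p y a)) := by
    have := (hd.hasFDerivAt.hasLineDerivAt a).tendsto_slope_zero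
    simpa using this
  refine le_of_tendsto_of_tendsto (hl.norm.pow 2) (hl.inner tendsto_const_nhds) ?_
  filter_upwards [self_mem_nhdsWithin] with t ht
  have h1 := h.norm_sq_le (y + t • a) y
  rw [add_sub_cancel_left, real_inner_smul_right] at h1
  rw [norm_smul, mul_pow, real_inner_smul_left, norm_inv, Real.norm_eq_abs, inv_pow, sq_abs]
  have ht' : t ≠ 0 := ht
  calc (t ^ 2)⁻¹ * ‖p (y + t • a) - p y‖ ^ 2
      ≤ (t ^ 2)⁻¹ * (t * ⟪p (y + t • a) - p y, a⟫) := by gcongr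
    _ = _ := by field_simp

/-- `p` is a gradient everywhere, so its derivative at `y` is a Hessian; symmetry needs
differentiability of the gradient at that single point only. -/
lemma IsProxWith.fderiv_symm [CompleteSpace E] {p : E → E} {ρ : E → ℝ} (h : IsProxWith p ρ) {y : E}
    (hd : DifferentiableAt ℝ p y) (a b : E) :
    ⟪fderiv ℝ p y a, b⟫ = ⟪a, fderiv ℝ p y b⟫ := by
  have h2 : HasFDerivAt (fun y => innerSL ℝ (p y)) ((innerSL ℝ).comp (fderiv ℝ p y)) y :=
    (innerSL ℝ).hasFDerivAt.comp y hd.hasFDerivAt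
  have := second_derivative_symmetric (fun y => h.hasFDerivAt_potential y) h2 a b
  simp only [ContinuousLinearMap.comp_apply, innerSL_apply_apply] at this
  rw [this, real_inner_comm]

lemma IsProxWith.fderiv_isPositive [CompleteSpace E] {p : E → E} {ρ : E → ℝ}
    (h : IsProxWith p ρ) {y : E} (hd : DifferentiableAt ℝ p y) : (fderiv ℝ p y).IsPositive :=
  ⟨fun a b => h.fderiv_symm hd a b,
    fun a => le_trans (sq_nonneg _) (h.fderiv_norm_sq_le hd a)⟩

/-- Rescaling and recentering a proximal map. -/
lemma IsProxWith.standardize {p : E → E} {ρ : E → ℝ} (h : IsProxWith p ρ) (μ : E) {σ : ℝ}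
    (hσ : σ ≠ 0) : IsProxWith (fun z => σ⁻¹ • (p (μ + σ • z) - μ))
      (fun z => (σ ^ 2)⁻¹ * ρ (μ + σ • z)) := by
  intro z z'
  have h1 := h (μ + σ • z) (μ + σ • z')
  have e1 : z - σ⁻¹ • (p (μ + σ • z) - μ) = σ⁻¹ • (μ + σ • z - p (μ + σ • z)) := by
    have : z = σ⁻¹ • (σ • z) := by rw [smul_smul, inv_mul_cancel₀ hσ, one_smul]
    nth_rw 1 [this]
    rw [← smul_sub]; congr 1; abel
  have e2 : σ⁻¹ • (p (μ + σ • z') - μ) - σ⁻¹ • (p (μ + σ • z) - μ)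
      = σ⁻¹ • (p (μ + σ • z') - p (μ + σ • z)) := by
    rw [← smul_sub]; congr 1; abel
  rw [e1, e2, real_inner_smul_left, real_inner_smul_right, ← mul_assoc, ← mul_inv, ← sq, ← mul_sub]
  gcongr

end Prox

/-- `ρ y` is the value of `r` at a chosen minimizer, finite by properness. Uniqueness of minimizers
plays no role. -/
lemma IsRegularizedRegression.exists_isProxWith {d : ℕ} {B : Type*} [AddCommGroup B] [Module ℝ B]
    {A : B →ₗ[ℝ] EuclideanSpace ℝ (Fin d)} {r : B → EReal} (hr : IsProperConvex r)
    {p : EuclideanSpace ℝ (Fin d) → EuclideanSpace ℝ (Fin d)}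
    (hp : IsRegularizedRegression A r p) : ∃ ρ, IsProxWith p ρ := by
  choose b hb hpb using hp
  have hfin : ∀ y, r (b y) ≠ ⊤ := by
    intro y htop
    obtain ⟨b₀, hb₀⟩ := hr.exists_ne_top
    have h1 := hb y b₀
    unfold objective at h1
    rw [htop, EReal.coe_add_top, top_le_iff] at h1
    exact EReal.add_ne_top (EReal.coe_ne_top _) hb₀ h1
  have hcoe : ∀ y, r (b y) = ((r (b y)).toReal : EReal) := fun y =>
    (EReal.coe_toReal (hfin y) (hr.ne_bot _)).symm
  refine ⟨fun y => (r (b y)).toReal, fun y y' => ?_⟩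
  set ρ := (r (b y)).toReal with hρ
  set ρ' := (r (b y')).toReal with hρ'
  rw [hpb y, hpb y']
  set u := A (b y)
  set u' := A (b y')
  -- Minimality is tested at the point of parameter `t` on the segment joining the two minimizers.
  -- After division by `t` the quadratic term is still of order `t` and vanishes in the limit.
  have key : ∀ t : ℝ, 0 < t → t ≤ 1 → ⟪y - u, u' - u⟫ ≤ ρ' - ρ + t / 2 * ‖u' - u‖ ^ 2 := by
    intro t ht ht1
    have hc := hr.convex_epigraph (x := (b y, ρ)) (hcoe y).le (y := (b y', ρ')) (hcoe y').le
      (sub_nonneg.2 ht1) ht.le (sub_add_cancel 1 t)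
    have hc' : r ((1 - t) • b y + t • b y') ≤ (((1 - t) * ρ + t * ρ' : ℝ) : EReal) := hc
    have h1 := (hb y ((1 - t) • b y + t • b y')).trans (add_le_add_right hc' _)
    unfold objective at h1
    rw [hcoe y, ← hρ] at h1
    simp only [map_add, map_smul] at h1
    rw [← EReal.coe_add, ← EReal.coe_add, EReal.coe_le_coe_iff] at h1
    have e : (1 - t) • A (b y) + t • A (b y') - y = (u - y) + t • (u' - u) := by
      simp only [u, u', smul_sub, sub_smul, one_smul]; abel
    rw [e, norm_add_sq_real, real_inner_smul_right, norm_smul, mul_pow, Real.norm_eq_abs,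
      sq_abs] at h1
    have e2 : ⟪y - u, u' - u⟫ = - ⟪u - y, u' - u⟫ := by rw [← inner_neg_left, neg_sub]
    rw [e2]
    have h2 : 0 ≤ t * (⟪u - y, u' - u⟫ + t / 2 * ‖u' - u‖ ^ 2 + (ρ' - ρ)) := by linarith
    have := nonneg_of_mul_nonneg_right h2 ht
    linarith
  have hlim : Filter.Tendsto (fun t : ℝ => ρ' - ρ + t / 2 * ‖u' - u‖ ^ 2) (𝓝[>] 0)
      (𝓝 (ρ' - ρ + 0 / 2 * ‖u' - u‖ ^ 2)) :=
    (Continuous.tendsto (by fun_prop) 0).mono_left nhdsWithin_le_nhds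
  have := ge_of_tendsto hlim (b := ⟪y - u, u' - u⟫) (by
    filter_upwards [Ioc_mem_nhdsGT (zero_lt_one' ℝ)] with t ht using key t ht.1 ht.2)
  simpa using this

/-! ### Density of the standard Gaussian measure and integration by parts. -/

section GaussianDensity

variable {E : Type*} [NormedAddCommGroup E] [InnerProductSpace ℝ E] [FiniteDimensional ℝ E]
  [MeasurableSpace E] [BorelSpace E]

variable (E) in
/-- The mass of the unnormalized standard Gaussian density. -/
noncomputable def gaussianMass : ℝ := ∫ x : E, Real.exp (-‖x‖ ^ 2 / 2)

/-- The density of the standard Gaussian measure. -/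
noncomputable def gaussianDensity (x : E) : ℝ := (gaussianMass E)⁻¹ * Real.exp (-‖x‖ ^ 2 / 2)

/-- The mass is never evaluated: the case `t = 0` identifies it with the power of π in the Fourier
formula. -/
lemma integral_cexp_gaussian (t : E) :
    ∫ x : E, Complex.exp (-‖x‖ ^ 2 / 2 + ⟪x, t⟫ * Complex.I) =
      (gaussianMass E : ℂ) * Complex.exp (-‖t‖ ^ 2 / 2) := by
  have h := fun (w : E) => GaussianFourier.integral_cexp_neg_mul_sq_norm_add (b := 1 / 2) (by simp)
    Complex.I w
  have h0 : (gaussianMass E : ℂ) = (Real.pi / (1 / 2 : ℂ)) ^ (Module.finrank ℝ E / 2 : ℂ) := by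
    have := h 0
    simp only [inner_zero_left, Complex.ofReal_zero, mul_zero, add_zero, norm_zero, ne_eq,
      OfNat.ofNat_ne_zero, not_false_eq_true, zero_pow, zero_div, Complex.exp_zero, mul_one] at this
    rw [← this, gaussianMass, ← integral_complex_ofReal]
    congr with x
    push_cast
    congr 1
    ring
  rw [h0]
  convert! h t using 3
  · congr 1
    rw [real_inner_comm]
    ring
  · rw [Complex.I_sq]
    ring

lemma integrable_exp_neg_norm_sq : Integrable fun x : E => Real.exp (-‖x‖ ^ 2 / 2) := by
  have := GaussianFourier.integrable_cexp_neg_mul_sq_norm_add (V := E) (b := 1 / 2) (by simp) 0 0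
  have h2 := this.norm
  refine h2.congr (Filter.Eventually.of_forall fun x => ?_)
  simp only [zero_mul, add_zero, Complex.norm_exp]
  rw [show (-(1 / 2) * (‖x‖ : ℂ) ^ 2) = ((-‖x‖ ^ 2 / 2 : ℝ) : ℂ) by push_cast; ring,
    Complex.ofReal_re]

lemma gaussianMass_pos : 0 < gaussianMass E := by
  unfold gaussianMass
  rw [integral_pos_iff_support_of_nonneg (fun x => (Real.exp_pos _).le) integrable_exp_neg_norm_sq]
  have : Function.support (fun x : E => Real.exp (-‖x‖ ^ 2 / 2)) = Set.univ := by
    ext x; simp [(Real.exp_pos _).ne']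
  rw [this]
  exact isOpen_univ.measure_pos _ Set.univ_nonempty

lemma gaussianDensity_pos (x : E) : 0 < gaussianDensity x :=
  mul_pos (inv_pos.2 gaussianMass_pos) (Real.exp_pos _)

@[fun_prop]
lemma measurable_gaussianDensity : Measurable (gaussianDensity (E := E)) := by
  unfold gaussianDensity; fun_prop

/-- Both measures have characteristic function exp(-‖t‖²/2). -/
lemma stdGaussian_eq_withDensity :
    stdGaussian E = volume.withDensity fun x => ENNReal.ofReal (gaussianDensity x) := by
  have hinteg : Integrable (gaussianDensity (E := E)) := integrable_exp_neg_norm_sq.const_mul _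
  have : IsFiniteMeasure (volume.withDensity fun x : E => ENNReal.ofReal (gaussianDensity x)) :=
    isFiniteMeasure_withDensity_ofReal hinteg.2
  refine Measure.ext_of_charFun ?_
  ext t
  rw [charFun_stdGaussian, charFun_apply, integral_withDensity_eq_integral_toReal_smul
    (by fun_prop) (by simp)]
  have h := integral_cexp_gaussian t
  have hm : (gaussianMass E : ℂ) ≠ 0 := by exact_mod_cast gaussianMass_pos.ne'
  rw [eq_comm, ← mul_right_inj' hm, ← h, ← integral_const_mul]
  congr with x
  rw [ENNReal.toReal_ofReal (gaussianDensity_pos x).le, gaussianDensity, Complex.exp_add,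
    Complex.real_smul]
  push_cast
  field_simp

lemma integrable_stdGaussian_iff {f : E → ℝ} :
    Integrable f (stdGaussian E) ↔ Integrable fun x => f x * gaussianDensity x := by
  rw [stdGaussian_eq_withDensity, integrable_withDensity_iff (by fun_prop) (by simp)]
  simp only [ENNReal.toReal_ofReal (gaussianDensity_pos _).le]

lemma integral_stdGaussian_eq (f : E → ℝ) :
    ∫ x, f x ∂(stdGaussian E) = ∫ x, f x * gaussianDensity x := by
  rw [stdGaussian_eq_withDensity, integral_withDensity_eq_integral_toReal_smul
    (by fun_prop) (by simp)]
  simp only [ENNReal.toReal_ofReal (gaussianDensity_pos _).le, smul_eq_mul, mul_comm]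

lemma stdGaussian_absolutelyContinuous : stdGaussian E ≪ volume := by
  rw [stdGaussian_eq_withDensity]
  exact withDensity_absolutelyContinuous _ _

lemma hasFDerivAt_gaussianDensity (x : E) :
    HasFDerivAt gaussianDensity (-(gaussianDensity x) • innerSL ℝ x) x := by
  have h1 : HasFDerivAt (fun x : E => -‖x‖ ^ 2 / 2) (-innerSL ℝ x) x := by
    have h2 := (hasStrictFDerivAt_norm_sq x).hasFDerivAt.const_mul (-(1 / 2) : ℝ)
    refine (h2.congr_fderiv ?_).congr_of_eventuallyEq (Filter.Eventually.of_forall fun y => ?_)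
    · ext a
      simp
    · simp only; ring
  have h3 := h1.exp.const_mul (gaussianMass E)⁻¹
  refine h3.congr_fderiv ?_
  ext a
  simp [gaussianDensity]
  ring

/-- Stein's identity: integration by parts for the standard Gaussian measure. -/
theorem integral_inner_mul_stdGaussian {ψ : E → ℝ} {a : E} (hd : Differentiable ℝ ψ)
    (h₀ : Integrable ψ (stdGaussian E))
    (h₁ : Integrable (fun x => ⟪x, a⟫ * ψ x) (stdGaussian E))
    (h₂ : Integrable (fun x => fderiv ℝ ψ x a) (stdGaussian E)) :
    ∫ x, ⟪x, a⟫ * ψ x ∂(stdGaussian E) = ∫ x, fderiv ℝ ψ x a ∂(stdGaussian E) := by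
  rw [integrable_stdGaussian_iff] at h₀ h₁ h₂
  rw [integral_stdGaussian_eq, integral_stdGaussian_eq]
  have hg : ∀ x : E, fderiv ℝ gaussianDensity x a = -(⟪x, a⟫ * gaussianDensity x) := fun x => by
    rw [(hasFDerivAt_gaussianDensity x).fderiv]; simp [mul_comm]
  have h1' : Integrable fun x => ψ x * fderiv ℝ gaussianDensity x a := by
    refine h₁.neg.congr (Filter.Eventually.of_forall fun x => ?_)
    simp only [Pi.neg_apply, hg]; ring
  have := integral_mul_fderiv_eq_neg_fderiv_mul_of_integrable h₂ h1' h₀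
    (fun x _ => hd x) (fun x _ => (hasFDerivAt_gaussianDensity x).differentiableAt)
  rw [eq_comm, ← neg_inj, ← this, ← integral_neg]
  congr with x
  rw [hg]; ring

lemma integrable_norm_pow_stdGaussian (n : ℕ) :
    Integrable (fun x => ‖x‖ ^ n) (stdGaussian E) := by
  rcases Nat.eq_zero_or_pos n with rfl | hn
  · simp
  have := (IsGaussian.memLp_id (stdGaussian E) n (by simp)).integrable_norm_pow hn.ne'
  simpa using this

lemma integrable_one_add_norm_pow_stdGaussian (n : ℕ) :
    Integrable (fun x => (1 + ‖x‖) ^ n) (stdGaussian E) := by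
  simp only [add_comm (1 : ℝ), add_pow, one_pow, mul_one]
  exact integrable_finsetSum _ fun k _ => (integrable_norm_pow_stdGaussian k).mul_const _

end GaussianDensity

/-! ### The Gaussian Poincaré inequality by rotation of two independent copies. -/

section Poincare

variable {E : Type*} [NormedAddCommGroup E] [InnerProductSpace ℝ E] [FiniteDimensional ℝ E]
  [MeasurableSpace E] [BorelSpace E]

lemma measurePreserving_rotation_stdGaussian (θ : ℝ) :
    MeasurePreserving (ContinuousLinearMap.rotation θ : E × E →L[ℝ] E × E)
      ((stdGaussian E).prod (stdGaussian E)) ((stdGaussian E).prod (stdGaussian E)) :=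
  ⟨by fun_prop, IsGaussian.map_rotation_eq_self (by simp) θ⟩

lemma integral_comp_rotation_stdGaussian (θ : ℝ) {G : E × E → ℝ} (hG : Continuous G) :
    ∫ q, G (Real.cos θ • q.1 + Real.sin θ • q.2, -Real.sin θ • q.1 + Real.cos θ • q.2)
      ∂((stdGaussian E).prod (stdGaussian E)) =
    ∫ q, G q ∂((stdGaussian E).prod (stdGaussian E)) := by
  have h := measurePreserving_rotation_stdGaussian (E := E) θ
  conv_rhs => rw [← h.map_eq]
  rw [integral_map h.measurable.aemeasurable hG.aestronglyMeasurable]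
  rfl

lemma integrable_norm_add_norm_stdGaussian_prod :
    Integrable (fun q : E × E => ‖q.1‖ + ‖q.2‖) ((stdGaussian E).prod (stdGaussian E)) := by
  have h : Integrable (fun x : E => ‖x‖) (stdGaussian E) := by
    simpa using integrable_norm_pow_stdGaussian (E := E) 1
  exact (h.comp_fst _).add (h.comp_snd _)

variable {u : E → ℝ} {M : ℝ}

/-- For independent Gaussian X, Y, the function E[u(X) u(cos θ X + sin θ Y)] interpolates between
E[u²] at θ = 0 and (E u)² at θ = π/2. -/
lemma hasDerivAt_integral_mul_rotation (hu : ContDiff ℝ 1 u) (hM : ∀ x, |u x| ≤ M)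
    (hM' : ∀ x, ‖fderiv ℝ u x‖ ≤ M) (θ : ℝ) :
    HasDerivAt (fun θ : ℝ => ∫ q, u q.1 * u (Real.cos θ • q.1 + Real.sin θ • q.2)
        ∂((stdGaussian E).prod (stdGaussian E)))
      (∫ q, u q.1 * fderiv ℝ u (Real.cos θ • q.1 + Real.sin θ • q.2)
        (-Real.sin θ • q.1 + Real.cos θ • q.2) ∂((stdGaussian E).prod (stdGaussian E))) θ := by
  have hM0 : 0 ≤ M := (abs_nonneg _).trans (hM 0)
  have hc := hu.continuous
  have hc' : Continuous (fderiv ℝ u) := hu.continuous_fderiv one_ne_zero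
  refine (hasDerivAt_integral_of_dominated_loc_of_deriv_le (𝕜 := ℝ) (s := Set.univ)
    (F := fun (θ : ℝ) (q : E × E) => u q.1 * u (Real.cos θ • q.1 + Real.sin θ • q.2))
    (F' := fun (θ : ℝ) (q : E × E) => u q.1 * fderiv ℝ u (Real.cos θ • q.1 + Real.sin θ • q.2)
        (-Real.sin θ • q.1 + Real.cos θ • q.2))
    (bound := fun q : E × E => M * (M * (‖q.1‖ + ‖q.2‖)))
    Filter.univ_mem (Filter.Eventually.of_forall fun θ => ?_) ?_ ?_ ?_ ?_ ?_).2
  · exact (by fun_prop : Continuous _).aestronglyMeasurable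
  · refine Integrable.of_bound (C := M * M)
      (by fun_prop : Continuous _).aestronglyMeasurable
      (Filter.Eventually.of_forall fun q => ?_)
    rw [norm_mul]
    exact mul_le_mul (hM _) (hM _) (norm_nonneg _) hM0
  · exact (by fun_prop : Continuous _).aestronglyMeasurable
  · refine Filter.Eventually.of_forall fun q θ _ => ?_
    rw [norm_mul]
    refine mul_le_mul (hM _) ?_ (norm_nonneg _) hM0
    refine ((fderiv ℝ u _).le_opNorm _).trans
      (mul_le_mul (hM' _) ?_ (norm_nonneg _) hM0)
    refine (norm_add_le _ _).trans (add_le_add ?_ ?_)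
    · rw [norm_smul, norm_neg]
      exact mul_le_of_le_one_left (norm_nonneg _) (Real.abs_sin_le_one θ)
    · rw [norm_smul]
      exact mul_le_of_le_one_left (norm_nonneg _) (Real.abs_cos_le_one θ)
  · exact (integrable_norm_add_norm_stdGaussian_prod.const_mul M).const_mul M
  · refine Filter.Eventually.of_forall fun q θ _ => ?_
    have h1 : HasDerivAt (fun θ : ℝ => Real.cos θ • q.1 + Real.sin θ • q.2)
        (-Real.sin θ • q.1 + Real.cos θ • q.2) θ :=
      ((Real.hasDerivAt_cos θ).smul_const q.1).add ((Real.hasDerivAt_sin θ).smul_const q.2)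
    exact (((hu.differentiable one_ne_zero _).hasFDerivAt.comp_hasDerivAt θ h1)).const_mul _

/-- With c = cos θ and s = sin θ, rotation invariance turns the integral into E[u(cX - sY) Du(X)Y].
Stein's identity in Y, with X fixed, makes it -s E⟪∇u(cX - sY), ∇u(X)⟫. Then ab ≤ (a² + b²)/2
applies, and both squares have the same mean. -/
lemma integral_mul_fderiv_rotation_ge (hu : ContDiff ℝ 1 u) (hM : ∀ x, |u x| ≤ M)
    (hM' : ∀ x, ‖fderiv ℝ u x‖ ≤ M) {θ : ℝ} (hθ : 0 ≤ Real.sin θ) :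
    -(Real.sin θ * ∫ x, ‖fderiv ℝ u x‖ ^ 2 ∂(stdGaussian E)) ≤
      ∫ q, u q.1 * fderiv ℝ u (Real.cos θ • q.1 + Real.sin θ • q.2)
        (-Real.sin θ • q.1 + Real.cos θ • q.2) ∂((stdGaussian E).prod (stdGaussian E)) := by
  have hM0 : 0 ≤ M := (abs_nonneg _).trans (hM 0)
  have hc := hu.continuous
  have hc' : Continuous (fderiv ℝ u) := hu.continuous_fderiv one_ne_zero
  set γ := stdGaussian E
  set c := Real.cos θ with hcθ
  set s := Real.sin θ with hsθ
  have hcs : c * c + s * s = 1 := by rw [← sq, ← sq]; exact Real.cos_sq_add_sin_sq θ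
  let G : E × E → ℝ := fun q => u (c • q.1 - s • q.2) * fderiv ℝ u q.1 q.2
  have hG : Continuous G := by fun_prop
  have h1 : ∫ q, u q.1 * fderiv ℝ u (c • q.1 + s • q.2) (-s • q.1 + c • q.2) ∂(γ.prod γ) =
      ∫ q, G q ∂(γ.prod γ) := by
    rw [← integral_comp_rotation_stdGaussian θ hG]
    congr with q
    simp only [G]
    congr 2
    rw [← hcθ, ← hsθ]
    have : q.1 = (c * c + s * s) • q.1 := by rw [hcs, one_smul]
    nth_rw 1 [this]
    module
  have hGi : Integrable G (γ.prod γ) := by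
    refine Integrable.mono' ((integrable_norm_add_norm_stdGaussian_prod.const_mul M).const_mul M)
      hG.aestronglyMeasurable (Filter.Eventually.of_forall fun q => ?_)
    rw [norm_mul]
    refine mul_le_mul (hM _) ?_ (norm_nonneg _) hM0
    refine ((fderiv ℝ u _).le_opNorm _).trans (mul_le_mul (hM' _) ?_ (norm_nonneg _) hM0)
    linarith [norm_nonneg q.1]
  let grad : E → E := fun x => (InnerProductSpace.toDual ℝ E).symm (fderiv ℝ u x)
  have hgc : Continuous grad := (InnerProductSpace.toDual ℝ E).symm.continuous.comp hc'
  have hgn : ∀ x, ‖grad x‖ = ‖fderiv ℝ u x‖ := fun x => LinearIsometryEquiv.norm_map _ _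
  have stein : ∀ x, ∫ v, G (x, v) ∂γ = ∫ v, -(s * fderiv ℝ u (c • x - s • v) (grad x)) ∂γ := by
    intro x
    have hψ : ∀ v, HasFDerivAt (fun v => u (c • x - s • v))
        ((fderiv ℝ u (c • x - s • v)).comp (-(s • ContinuousLinearMap.id ℝ E))) v := by
      intro v
      have : HasFDerivAt (fun v => c • x - s • v) (-(s • ContinuousLinearMap.id ℝ E)) v :=
        ((hasFDerivAt_id v).const_smul s).const_sub _
      exact (hu.differentiable one_ne_zero _).hasFDerivAt.comp v this
    have hfd : ∀ v, fderiv ℝ (fun v => u (c • x - s • v)) v (grad x) =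
        -(s * fderiv ℝ u (c • x - s • v) (grad x)) := by
      intro v; rw [(hψ v).fderiv]; simp
    have := integral_inner_mul_stdGaussian (ψ := fun v => u (c • x - s • v)) (a := grad x)
      (fun v => (hψ v).differentiableAt)
      (Integrable.of_bound (C := M) (by fun_prop : Continuous _).aestronglyMeasurable
        (Filter.Eventually.of_forall fun v => hM _)) ?_ ?_
    · simp only [hfd] at this
      rw [← this]
      congr with v
      simp only [G, grad]
      rw [real_inner_comm, InnerProductSpace.toDual_symm_apply, mul_comm]
    · refine Integrable.mono' ((integrable_norm_pow_stdGaussian 1).const_mul (‖grad x‖ * M))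
        (by fun_prop : Continuous _).aestronglyMeasurable
        (Filter.Eventually.of_forall fun v => ?_)
      rw [norm_mul, pow_one]
      calc _ ≤ (‖v‖ * ‖grad x‖) * M :=
            mul_le_mul (norm_inner_le_norm _ _) (hM _) (abs_nonneg _) (by positivity)
        _ = _ := by ring
    · simp only [hfd]
      refine Integrable.of_bound (C := s * (M * ‖grad x‖))
        (by fun_prop : Continuous _).aestronglyMeasurable
        (Filter.Eventually.of_forall fun v => ?_)
      rw [norm_neg, norm_mul, Real.norm_of_nonneg hθ]
      gcongr
      exact ((fderiv ℝ u _).le_opNorm _).trans (by gcongr; exact hM' _)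
  have hDi : Integrable (fun x => ‖fderiv ℝ u x‖ ^ 2) γ :=
    Integrable.of_bound (C := M ^ 2) (by fun_prop : Continuous _).aestronglyMeasurable
      (Filter.Eventually.of_forall fun v => by
        rw [norm_pow, norm_norm]; gcongr; exact hM' _)
  have hHi : Integrable (fun q : E × E => ‖fderiv ℝ u (c • q.1 - s • q.2)‖ ^ 2) (γ.prod γ) :=
    Integrable.of_bound (C := M ^ 2) (by fun_prop : Continuous _).aestronglyMeasurable
      (Filter.Eventually.of_forall fun v => by
        rw [norm_pow, norm_norm]; gcongr; exact hM' _)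
  have hKi : Integrable (fun q : E × E => -(s * fderiv ℝ u (c • q.1 - s • q.2) (grad q.1)))
      (γ.prod γ) := by
    refine Integrable.of_bound (C := s * (M * M))
      (by fun_prop : Continuous _).aestronglyMeasurable
      (Filter.Eventually.of_forall fun q => ?_)
    rw [norm_neg, norm_mul, Real.norm_of_nonneg hθ]
    gcongr
    refine ((fderiv ℝ u _).le_opNorm _).trans (mul_le_mul (hM' _) ?_ (norm_nonneg _) hM0)
    rw [hgn]; exact hM' _
  have hfst : ∫ q : E × E, ‖fderiv ℝ u q.1‖ ^ 2 ∂(γ.prod γ) = ∫ x, ‖fderiv ℝ u x‖ ^ 2 ∂γ := by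
    have := integral_fun_fst (μ := γ) (ν := γ) (fun x => ‖fderiv ℝ u x‖ ^ 2)
    simpa using this
  have hrot : ∫ q : E × E, ‖fderiv ℝ u (c • q.1 - s • q.2)‖ ^ 2 ∂(γ.prod γ) =
      ∫ x, ‖fderiv ℝ u x‖ ^ 2 ∂γ := by
    -- cX - sY is the first coordinate of the rotation by -θ.
    rw [← hfst, ← integral_comp_rotation_stdGaussian (-θ) (G := fun q => ‖fderiv ℝ u q.1‖ ^ 2)
      (by fun_prop)]
    simp only [Real.cos_neg, Real.sin_neg, neg_smul, ← sub_eq_add_neg, ← hcθ, ← hsθ]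
    rfl
  rw [h1, integral_prod _ hGi]
  simp only [stein]
  rw [← integral_prod _ hKi]
  calc -(s * ∫ x, ‖fderiv ℝ u x‖ ^ 2 ∂γ)
      = ∫ q : E × E, -(s * (1 / 2 * (‖fderiv ℝ u (c • q.1 - s • q.2)‖ ^ 2
          + ‖fderiv ℝ u q.1‖ ^ 2))) ∂(γ.prod γ) := by
        rw [integral_neg, integral_const_mul, integral_const_mul,
          integral_add hHi (hDi.comp_fst _), hrot, hfst]
        ring
    _ ≤ _ := by
        refine integral_mono (((hHi.add (hDi.comp_fst _)).const_mul _).const_mul _).neg hKi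
          fun q => ?_
        simp only
        refine neg_le_neg (mul_le_mul_of_nonneg_left ?_ hθ)
        have h2 := (le_abs_self _).trans ((fderiv ℝ u (c • q.1 - s • q.2)).le_opNorm (grad q.1))
        rw [hgn] at h2
        nlinarith [sq_nonneg (‖fderiv ℝ u (c • q.1 - s • q.2)‖ - ‖fderiv ℝ u q.1‖)]

/-- The Gaussian Poincaré inequality for bounded `C¹` functions with bounded derivative. -/
theorem integral_sq_sub_sq_integral_le_stdGaussian (hu : ContDiff ℝ 1 u) (hM : ∀ x, |u x| ≤ M)
    (hM' : ∀ x, ‖fderiv ℝ u x‖ ≤ M) :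
    ∫ x, u x ^ 2 ∂(stdGaussian E) - (∫ x, u x ∂(stdGaussian E)) ^ 2 ≤
      ∫ x, ‖fderiv ℝ u x‖ ^ 2 ∂(stdGaussian E) := by
  set D := ∫ x, ‖fderiv ℝ u x‖ ^ 2 ∂(stdGaussian E) with hD
  -- The interpolation minus D cos θ is nondecreasing on [0, π/2]; comparing its endpoint values
  -- gives the inequality.
  have hderiv := fun θ : ℝ =>
    (hasDerivAt_integral_mul_rotation hu hM hM' θ).sub ((Real.hasDerivAt_cos θ).const_mul D)
  have hmono := monotoneOn_of_deriv_nonneg (convex_Icc 0 (Real.pi / 2))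
    (fun θ _ => (hderiv θ).continuousAt.continuousWithinAt)
    (fun θ _ => (hderiv θ).differentiableAt.differentiableWithinAt)
    (fun θ hθ => by
      rw [interior_Icc] at hθ
      have hs : 0 ≤ Real.sin θ :=
        Real.sin_nonneg_of_nonneg_of_le_pi hθ.1.le (by linarith [hθ.2, Real.pi_pos])
      rw [(hderiv θ).deriv]
      have := integral_mul_fderiv_rotation_ge hu hM hM' hs
      linarith)
  have h := hmono (Set.left_mem_Icc.2 (by positivity)) (Set.right_mem_Icc.2 (by positivity))
    (by positivity : (0 : ℝ) ≤ Real.pi / 2)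
  simp only [Pi.sub_apply, Real.cos_zero, Real.sin_zero, Real.cos_pi_div_two, Real.sin_pi_div_two,
    one_smul, zero_smul, add_zero, zero_add, mul_one, mul_zero, sub_zero] at h
  have e1 : ∫ q : E × E, u q.1 * u q.1 ∂((stdGaussian E).prod (stdGaussian E)) =
      ∫ x, u x ^ 2 ∂(stdGaussian E) := by
    have := integral_fun_fst (μ := stdGaussian E) (ν := stdGaussian E) (fun x => u x * u x)
    simpa [sq] using this
  rw [e1, integral_prod_mul] at h
  linarith

end Poincare

/-! ### Gaussian divergence and the second order Stein identity. -/

section SecondOrderStein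

variable {d : ℕ}

local notation "E" => EuclideanSpace ℝ (Fin d)
local notation "γ" => stdGaussian (EuclideanSpace ℝ (Fin d))

/-- The adjoint of the gradient in `L²` of the standard Gaussian measure. -/
noncomputable def gaussianDivergence (h : E → E) (x : E) : ℝ := ⟪x, h x⟫ - divergence h x

/-- The trace of the square of a linear endomorphism. -/
noncomputable def traceSq (T : E →L[ℝ] E) : ℝ := ∑ j, T (T (EuclideanSpace.single j 1)) j

lemma inner_eq_sum_mul_inner_single (x y : E) :
    ⟪x, y⟫ = ∑ j, ⟪x, EuclideanSpace.single j (1 : ℝ)⟫ * y j := by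
  simp [PiLp.inner_apply, mul_comm]

lemma sum_apply_smul_single (x : E) : ∑ j, x j • EuclideanSpace.single j (1 : ℝ) = x := by
  ext i
  simp [Pi.single_apply]

lemma contDiff_divergence {h : E → E} (hh : ContDiff ℝ 2 h) : ContDiff ℝ 1 (divergence h) := by
  have h1 : ContDiff ℝ 1 (fderiv ℝ h) := hh.fderiv_right (by norm_num)
  unfold divergence
  refine ContDiff.sum fun i _ => ?_
  exact (EuclideanSpace.proj (𝕜 := ℝ) i).contDiff.comp (h1.clm_apply contDiff_const)

lemma contDiff_gaussianDivergence {h : E → E} (hh : ContDiff ℝ 2 h) :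
    ContDiff ℝ 1 (gaussianDivergence h) :=
  (contDiff_id.inner ℝ (hh.of_le (by norm_num))).sub (contDiff_divergence hh)

lemma continuous_divergence {h : E → E} (hh : ContDiff ℝ 1 h) : Continuous (divergence h) := by
  have := hh.continuous_fderiv one_ne_zero
  unfold divergence
  fun_prop

lemma continuous_gaussianDivergence {h : E → E} (hh : ContDiff ℝ 1 h) :
    Continuous (gaussianDivergence h) :=
  (continuous_id.inner hh.continuous).sub (continuous_divergence hh)

/-- A continuous function vanishing wherever a compactly supported `h` and its derivative vanish
is integrable. -/
lemma integrable_of_eq_zero_of_hasCompactSupport {h : E → E} (hc : HasCompactSupport h) {f : E → ℝ}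
    (hf : Continuous f) (h0 : ∀ x, h x = 0 → fderiv ℝ h x = 0 → f x = 0) :
    Integrable f γ := by
  refine hf.integrable_of_hasCompactSupport (HasCompactSupport.intro hc fun x hx => ?_)
  exact h0 x (image_eq_zero_of_notMem_tsupport hx) (fderiv_of_notMem_tsupport ℝ hx)

lemma integral_inner_mul_of_hasCompactSupport {ψ : E → ℝ} (hψ : ContDiff ℝ 1 ψ)
    (hc : HasCompactSupport ψ) (a : E) :
    ∫ x, ⟪x, a⟫ * ψ x ∂γ = ∫ x, fderiv ℝ ψ x a ∂γ := by
  have h1 := hψ.continuous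
  have h2 := hψ.continuous_fderiv one_ne_zero
  refine integral_inner_mul_stdGaussian (hψ.differentiable one_ne_zero)
    (h1.integrable_of_hasCompactSupport hc)
    (Continuous.integrable_of_hasCompactSupport (by fun_prop) hc.mul_left)
    (Continuous.integrable_of_hasCompactSupport (by fun_prop) (hc.fderiv_apply ℝ a))

/-- Duality between the gradient and the Gaussian divergence. -/
lemma integral_gaussianDivergence_mul {h : E → E} (hh : ContDiff ℝ 1 h) (hc : HasCompactSupport h)
    {u : E → ℝ} (hu : ContDiff ℝ 1 u) :
    ∫ x, gaussianDivergence h x * u x ∂γ = ∫ x, fderiv ℝ u x (h x) ∂γ := by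
  have hcont := hh.continuous
  have hcont' := hh.continuous_fderiv one_ne_zero
  have ucont := hu.continuous
  have ucont' := hu.continuous_fderiv one_ne_zero
  have hfd : ∀ (i : Fin d) (x : E), fderiv ℝ (fun x => h x i * u x) x (EuclideanSpace.single i 1) =
      fderiv ℝ h x (EuclideanSpace.single i 1) i * u x
        + h x i * fderiv ℝ u x (EuclideanSpace.single i 1) := by
    intro i x
    have h1 : HasFDerivAt (fun x => h x i)
        ((EuclideanSpace.proj (𝕜 := ℝ) i).comp (fderiv ℝ h x)) x :=
      (EuclideanSpace.proj (𝕜 := ℝ) i).hasFDerivAt.comp x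
        (hh.differentiable one_ne_zero x).hasFDerivAt
    rw [(h1.fun_mul (hu.differentiable one_ne_zero x).hasFDerivAt).fderiv]
    simp
    ring
  have hst : ∀ i : Fin d, ∫ x, ⟪x, EuclideanSpace.single i (1 : ℝ)⟫ * (h x i * u x) ∂γ =
      ∫ x, fderiv ℝ h x (EuclideanSpace.single i 1) i * u x ∂γ
        + ∫ x, h x i * fderiv ℝ u x (EuclideanSpace.single i 1) ∂γ := by
    intro i
    rw [integral_inner_mul_of_hasCompactSupport]
    · simp only [hfd]
      refine integral_add ?_ ?_ <;>
      · refine integrable_of_eq_zero_of_hasCompactSupport hc (by fun_prop) fun x h1 h2 => ?_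
        simp [h1, h2]
    · exact ((EuclideanSpace.proj (𝕜 := ℝ) i).contDiff.comp hh).mul hu
    · exact HasCompactSupport.intro hc fun x hx => by
        simp [image_eq_zero_of_notMem_tsupport hx]
  have e1 : ∀ x, gaussianDivergence h x * u x =
      ∑ i, ⟪x, EuclideanSpace.single i (1 : ℝ)⟫ * (h x i * u x)
        - ∑ i, fderiv ℝ h x (EuclideanSpace.single i 1) i * u x := by
    intro x
    rw [gaussianDivergence, inner_eq_sum_mul_inner_single, divergence, sub_mul, Finset.sum_mul,
      Finset.sum_mul]
    simp only [mul_assoc]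
  have e2 : ∀ x, fderiv ℝ u x (h x) =
      ∑ i, h x i * fderiv ℝ u x (EuclideanSpace.single i 1) := by
    intro x
    nth_rw 1 [← sum_apply_smul_single (h x)]
    simp
  simp only [e1, e2]
  rw [integral_sub, integral_finsetSum, integral_finsetSum, integral_finsetSum,
    ← Finset.sum_sub_distrib]
  · refine Finset.sum_congr rfl fun i _ => ?_
    rw [hst]; ring
  any_goals intro i _
  any_goals
    refine integrable_of_eq_zero_of_hasCompactSupport hc (by fun_prop) fun x h1 h2 => ?_
    simp [h1, h2]

lemma integral_gaussianDivergence {h : E → E} (hh : ContDiff ℝ 1 h) (hc : HasCompactSupport h) :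
    ∫ x, gaussianDivergence h x ∂γ = 0 := by
  simpa using integral_gaussianDivergence_mul hh hc (u := fun _ => 1) contDiff_const

/-- The second order Stein identity. -/
theorem integral_gaussianDivergence_sq {h : E → E} (hh : ContDiff ℝ 2 h)
    (hc : HasCompactSupport h) :
    ∫ x, gaussianDivergence h x ^ 2 ∂γ =
      ∫ x, ‖h x‖ ^ 2 ∂γ + ∫ x, traceSq (fderiv ℝ h x) ∂γ := by
  have hh1 : ContDiff ℝ 1 h := hh.of_le (by norm_num)
  have hD : ContDiff ℝ 1 (fderiv ℝ h) := hh.fderiv_right (by norm_num)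
  have hcont := hh.continuous
  have hcont' := hD.continuous
  have hcont2 := hD.continuous_fderiv one_ne_zero
  have hdiff : ∀ x, HasFDerivAt h (fderiv ℝ h x) x := fun x =>
    (hh1.differentiable one_ne_zero x).hasFDerivAt
  have hdiff' : ∀ x, HasFDerivAt (fderiv ℝ h) (fderiv ℝ (fderiv ℝ h) x) x := fun x =>
    (hD.differentiable one_ne_zero x).hasFDerivAt
  -- The coordinates of Dh(h): these are the factors of x_j when δh is differentiated along `h`.
  let ψ : Fin d → E → ℝ := fun j x => fderiv ℝ h x (h x) j
  have hψ : ∀ j, ContDiff ℝ 1 (ψ j) := fun j =>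
    (EuclideanSpace.proj (𝕜 := ℝ) j).contDiff.comp (hD.clm_apply hh1)
  have hψc : ∀ j, HasCompactSupport (ψ j) := fun j => HasCompactSupport.intro hc fun x hx => by
    simp [ψ, image_eq_zero_of_notMem_tsupport hx]
  have hψ' : ∀ j x, fderiv ℝ (ψ j) x (EuclideanSpace.single j 1) =
      fderiv ℝ (fderiv ℝ h) x (h x) (EuclideanSpace.single j 1) j
        + fderiv ℝ h x (fderiv ℝ h x (EuclideanSpace.single j 1)) j := by
    intro j x
    have h1 : HasFDerivAt (ψ j) _ x :=
      (EuclideanSpace.proj (𝕜 := ℝ) j).hasFDerivAt.comp x ((hdiff' x).clm_apply (hdiff x))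
    have hs : IsSymmSndFDerivAt ℝ h x := hh.contDiffAt.isSymmSndFDerivAt (by simp)
    rw [h1.fderiv, hs.eq (h x)]
    simp [add_comm]
  have hfd : ∀ x, fderiv ℝ (gaussianDivergence h) x (h x) = ‖h x‖ ^ 2
      + ∑ j, (⟪x, EuclideanSpace.single j (1 : ℝ)⟫ * ψ j x
        - fderiv ℝ (fderiv ℝ h) x (h x) (EuclideanSpace.single j 1) j) := by
    intro x
    have h1 : HasFDerivAt (divergence h) (∑ j, (EuclideanSpace.proj (𝕜 := ℝ) j).comp
        ((fderiv ℝ (fderiv ℝ h) x).flip (EuclideanSpace.single j 1))) x := by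
      unfold divergence
      refine HasFDerivAt.fun_sum fun j _ => ?_
      refine (EuclideanSpace.proj (𝕜 := ℝ) j).hasFDerivAt.comp x ?_
      convert (hdiff' x).clm_apply (hasFDerivAt_const (EuclideanSpace.single j (1 : ℝ)) x) using 1
      ext a; simp
    have h2 := ((hasFDerivAt_id x).inner ℝ (hdiff x)).sub h1
    have h3 : fderiv ℝ (gaussianDivergence h) x = _ := h2.fderiv
    rw [h3, Finset.sum_sub_distrib, ← inner_eq_sum_mul_inner_single x (fderiv ℝ h x (h x)),
      ← real_inner_self_eq_norm_sq]
    simp [fderivInnerCLM_apply]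
    ring
  have key := integral_gaussianDivergence_mul hh1 hc (contDiff_gaussianDivergence hh)
  simp only [← sq, hfd] at key
  -- Stein's identity for `ψ j` produces the same second-derivative term, by symmetry of D²h. It
  -- cancels, leaving a diagonal entry of (Dh)².
  have hst : ∀ j, ∫ x, (⟪x, EuclideanSpace.single j (1 : ℝ)⟫ * ψ j x
        - fderiv ℝ (fderiv ℝ h) x (h x) (EuclideanSpace.single j 1) j) ∂γ =
      ∫ x, fderiv ℝ h x (fderiv ℝ h x (EuclideanSpace.single j 1)) j ∂γ := by
    intro j
    have hc1 := (hψ j).continuous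
    rw [integral_sub, integral_inner_mul_of_hasCompactSupport (hψ j) (hψc j)]
    · simp only [hψ']
      rw [integral_add]
      · ring
      all_goals
        refine integrable_of_eq_zero_of_hasCompactSupport hc (by fun_prop) fun x h1 h2 => ?_
        simp [h1, h2]
    all_goals
      refine integrable_of_eq_zero_of_hasCompactSupport hc (by fun_prop) fun x h1 h2 => ?_
      simp [ψ, h1, h2]
  rw [key, integral_add, integral_finsetSum, Finset.sum_congr rfl fun j _ => hst j,
    ← integral_finsetSum]
  · rfl
  any_goals intro j _
  any_goals
    have hc1 := fun j => (hψ j).continuous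
    refine integrable_of_eq_zero_of_hasCompactSupport hc (by fun_prop) fun x h1 h2 => ?_
    simp [ψ, h1, h2]

/-- A variance bound combining the Poincaré inequality and the second order Stein identity. -/
theorem variance_add_gaussianDivergence_le {u : E → ℝ} (hu : ContDiff ℝ 1 u)
    (huc : HasCompactSupport u) {h : E → E} (hh : ContDiff ℝ 2 h) (hc : HasCompactSupport h) :
    ∫ x, (u x + 2 * gaussianDivergence h x) ^ 2 ∂γ
        - (∫ x, (u x + 2 * gaussianDivergence h x) ∂γ) ^ 2 ≤
      ∫ x, (‖fderiv ℝ u x‖ ^ 2 + 4 * fderiv ℝ u x (h x) + 4 * ‖h x‖ ^ 2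
        + 4 * traceSq (fderiv ℝ h x)) ∂γ := by
  have hh1 : ContDiff ℝ 1 h := hh.of_le (by norm_num)
  have c1 := hh.continuous
  have c2 := hh1.continuous_fderiv one_ne_zero
  have c3 := hu.continuous
  have c4 := hu.continuous_fderiv one_ne_zero
  have c5 := continuous_gaussianDivergence hh1
  have c6 : Continuous fun x => traceSq (fderiv ℝ h x) := by unfold traceSq; fun_prop
  have hδ : ∀ x, h x = 0 → fderiv ℝ h x = 0 → gaussianDivergence h x = 0 := fun x h1 h2 => by
    simp [gaussianDivergence, divergence, h1, h2]
  have i1 : Integrable u γ := c3.integrable_of_hasCompactSupport huc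
  have i2 : Integrable (fun x => u x ^ 2) γ := by
    simp only [sq]
    exact Continuous.integrable_of_hasCompactSupport (by fun_prop) huc.mul_left
  have i3 : Integrable (gaussianDivergence h) γ :=
    integrable_of_eq_zero_of_hasCompactSupport hc c5 hδ
  have i4 : Integrable (fun x => gaussianDivergence h x * u x) γ :=
    integrable_of_eq_zero_of_hasCompactSupport hc (by fun_prop) fun x h1 h2 => by simp [hδ x h1 h2]
  have i5 : Integrable (fun x => gaussianDivergence h x ^ 2) γ :=
    integrable_of_eq_zero_of_hasCompactSupport hc (by fun_prop) fun x h1 h2 => by simp [hδ x h1 h2]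
  have i6 : Integrable (fun x => ‖h x‖ ^ 2) γ :=
    integrable_of_eq_zero_of_hasCompactSupport hc (by fun_prop) fun x h1 h2 => by simp [h1]
  have i7 : Integrable (fun x => traceSq (fderiv ℝ h x)) γ :=
    integrable_of_eq_zero_of_hasCompactSupport hc c6 fun x h1 h2 => by simp [h2, traceSq]
  have i8 : Integrable (fun x => fderiv ℝ u x (h x)) γ :=
    integrable_of_eq_zero_of_hasCompactSupport hc (by fun_prop) fun x h1 h2 => by simp [h1]
  have i9 : Integrable (fun x => ‖fderiv ℝ u x‖ ^ 2) γ := by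
    refine Continuous.integrable_of_hasCompactSupport (by fun_prop) ?_
    exact HasCompactSupport.intro (huc.fderiv ℝ) fun x hx => by
      simp [image_eq_zero_of_notMem_tsupport hx]
  obtain ⟨M₁, hM₁⟩ := c3.bounded_above_of_compact_support huc
  obtain ⟨M₂, hM₂⟩ := c4.bounded_above_of_compact_support (huc.fderiv ℝ)
  have hP := integral_sq_sub_sq_integral_le_stdGaussian hu (M := max M₁ M₂)
    (fun x => (hM₁ x).trans (le_max_left _ _)) (fun x => (hM₂ x).trans (le_max_right _ _))
  have e1 : ∀ x, (u x + 2 * gaussianDivergence h x) ^ 2 =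
      u x ^ 2 + 4 * (gaussianDivergence h x * u x) + 4 * gaussianDivergence h x ^ 2 :=
    fun x => by ring
  simp only [e1]
  rw [integral_add (i2.fun_add (i4.const_mul 4)) (i5.const_mul 4), integral_add i2 (i4.const_mul 4),
    integral_const_mul, integral_const_mul, integral_add i1 (i3.const_mul 2), integral_const_mul,
    integral_gaussianDivergence hh1 hc, integral_gaussianDivergence_mul hh1 hc hu,
    integral_gaussianDivergence_sq hh hc,
    integral_add ((i9.fun_add (i8.const_mul 4)).fun_add (i6.const_mul 4)) (i7.const_mul 4),
    integral_add (i9.fun_add (i8.const_mul 4)) (i6.const_mul 4), integral_add i9 (i8.const_mul 4),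
    integral_const_mul, integral_const_mul, integral_const_mul]
  linarith

end SecondOrderStein

/-! ### Smooth compactly supported approximation of Lipschitz maps. -/

section Approximation

open Convolution

variable {E : Type*} [NormedAddCommGroup E] [InnerProductSpace ℝ E] [FiniteDimensional ℝ E]
  [MeasurableSpace E] [BorelSpace E]
  {F : Type*} [NormedAddCommGroup F] [NormedSpace ℝ F]

/-- The sequence `G` of smooth compactly supported maps converges to `g`, together with its
derivatives, with linear growth uniform in the index. -/
structure IsSmoothApprox (g : E → F) (G : ℕ → E → F) (C : ℝ) : Prop where
  contDiff : ∀ n, ContDiff ℝ 2 (G n)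
  hasCompactSupport : ∀ n, HasCompactSupport (G n)
  nonneg : 0 ≤ C
  norm_le : ∀ n x, ‖G n x‖ ≤ C * (1 + ‖x‖)
  norm_fderiv_le : ∀ n x, ‖fderiv ℝ (G n) x‖ ≤ C * (1 + ‖x‖)
  tendsto : ∀ x, Filter.Tendsto (fun n => G n x) Filter.atTop (𝓝 (g x))
  tendsto_fderiv : ∀ᵐ x, Filter.Tendsto (fun n => fderiv ℝ (G n) x) Filter.atTop
    (𝓝 (fderiv ℝ g x))

variable [FiniteDimensional ℝ F]

/-- The derivative of the mollification of a Lipschitz map is the mollification of its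
derivative. -/
lemma hasFDerivAt_normed_convolution (φ : ContDiffBump (0 : E)) {g : E → F} {K : NNReal}
    (hg : LipschitzWith K g) (x : E) :
    HasFDerivAt (φ.normed volume ⋆[ContinuousLinearMap.lsmul ℝ ℝ, volume] g)
      ((φ.normed volume ⋆[ContinuousLinearMap.lsmul ℝ ℝ, volume] fderiv ℝ g) x) x := by
  borelize F
  have hgc := hg.continuous
  have hφc : Continuous (φ.normed (volume : Measure E)) := φ.continuous_normed
  have hmp : MeasurePreserving (fun t : E => x - t) volume volume :=
    Measure.measurePreserving_sub_left volume x
  refine (hasFDerivAt_integral_of_dominated_loc_of_lip (𝕜 := ℝ) (s := Set.univ)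
    (F := fun x t => φ.normed volume t • g (x - t))
    (F' := fun t => φ.normed volume t • fderiv ℝ g (x - t))
    (bound := fun t => φ.normed volume t * K) Filter.univ_mem
    (Filter.Eventually.of_forall fun x => ?_) ?_ ?_ ?_ ?_ ?_).2
  · exact (by fun_prop : Continuous _).aestronglyMeasurable
  · exact Continuous.integrable_of_hasCompactSupport (by fun_prop)
      φ.hasCompactSupport_normed.smul_right
  · refine hφc.aestronglyMeasurable.smul ?_
    have hm : StronglyMeasurable (fderiv ℝ g) := (measurable_fderiv ℝ g).stronglyMeasurable
    exact (hm.comp_measurable hmp.measurable).aestronglyMeasurable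
  · refine Filter.Eventually.of_forall fun t => LipschitzOnWith.of_dist_le_mul fun a _ b _ => ?_
    rw [dist_eq_norm, ← smul_sub, norm_smul, Real.norm_of_nonneg (φ.nonneg_normed t),
      Real.coe_nnabs, abs_of_nonneg (mul_nonneg (φ.nonneg_normed t) K.coe_nonneg), mul_assoc]
    refine mul_le_mul_of_nonneg_left ?_ (φ.nonneg_normed t)
    simpa [dist_eq_norm] using hg.dist_le_mul (a - t) (b - t)
  · exact φ.integrable_normed.mul_const _
  -- Rademacher's theorem: for fixed `x`, `g` is differentiable at `x - t` for almost every `t`.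
  · have h := hmp.quasiMeasurePreserving.ae (hg.ae_differentiableAt (μ := volume))
    filter_upwards [h] with t ht
    have h1 : HasFDerivAt (fun x => g (x - t)) (fderiv ℝ g (x - t)) x := by
      exact ht.hasFDerivAt.comp x ((hasFDerivAt_id x).sub_const t)
    exact h1.const_smul _

lemma norm_normed_convolution_le (φ : ContDiffBump (0 : E)) {G : Type*} [NormedAddCommGroup G]
    [NormedSpace ℝ G] {f : E → G} {K : ℝ} (hf : ∀ x, ‖f x‖ ≤ K) (x : E) :
    ‖(φ.normed volume ⋆[ContinuousLinearMap.lsmul ℝ ℝ, volume] f) x‖ ≤ K := by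
  have h := norm_integral_le_of_norm_le (f := fun t => φ.normed volume t • f (x - t))
    (φ.integrable_normed.mul_const K)
    (Filter.Eventually.of_forall fun t => by
      rw [norm_smul, Real.norm_of_nonneg (φ.nonneg_normed t)]
      exact mul_le_mul_of_nonneg_left (hf _) (φ.nonneg_normed t))
  rwa [integral_mul_const, φ.integral_normed, one_mul] at h

/-- Mollify at scale 1/(n+1), then multiply by the cutoff χ(x/(n+1)). Derivatives converge by
Lebesgue differentiation. The derivative of the cutoff meets a factor of linear growth, hence the
linear bound on derivatives; any polynomial bound is harmless for a Gaussian. -/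
theorem exists_isSmoothApprox {g : E → F} {K : NNReal} (hg : LipschitzWith K g) :
    ∃ G C, IsSmoothApprox g G C := by
  borelize F
  have hgc := hg.continuous
  -- The ratio of outer to inner radius stays equal to 2, as the Lebesgue differentiation theorem
  -- below requires (`K := 2`).
  let φ : ℕ → ContDiffBump (0 : E) := fun n =>
    ⟨1 / (2 * (n + 1)), 1 / (n + 1), by positivity, by
      rw [div_lt_div_iff₀ (by positivity) (by positivity)]; linarith [n.cast_nonneg (α := ℝ)]⟩
  let m : ℕ → E → F := fun n =>
    (φ n).normed volume ⋆[ContinuousLinearMap.lsmul ℝ ℝ, volume] g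
  let χ : ContDiffBump (0 : E) := ⟨1, 2, one_pos, one_lt_two⟩
  have hφ0 : Filter.Tendsto (fun n => (φ n).rOut) Filter.atTop (𝓝 0) :=
    tendsto_one_div_add_atTop_nhds_zero_nat
  have hφ1 : ∀ n, (φ n).rOut ≤ 1 := fun n => by
    simp only [φ]
    rw [div_le_one (by positivity)]; linarith [n.cast_nonneg (α := ℝ)]
  have hm : ∀ n, ContDiff ℝ 2 (m n) := fun n =>
    (φ n).hasCompactSupport_normed.contDiff_convolution_left (n := 2) _
      (φ n).contDiff_normed hgc.locallyIntegrable
  have hm' : ∀ n x, HasFDerivAt (m n)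
      (((φ n).normed volume ⋆[ContinuousLinearMap.lsmul ℝ ℝ, volume] fderiv ℝ g) x) x :=
    fun n x => hasFDerivAt_normed_convolution (φ n) hg x
  have hgb : ∀ x, ‖fderiv ℝ g x‖ ≤ K := fun x => norm_fderiv_le_of_lipschitz ℝ hg
  have hmb' : ∀ n x, ‖fderiv ℝ (m n) x‖ ≤ K := fun n x => by
    rw [(hm' n x).fderiv]; exact norm_normed_convolution_le (φ n) hgb x
  have hmb : ∀ n x, ‖m n x‖ ≤ (2 * K + ‖g 0‖) * (1 + ‖x‖) := by
    intro n x
    have h1 : dist (m n x) (g x) ≤ K := (φ n).dist_normed_convolution_le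
      hgc.aestronglyMeasurable fun y hy => by
        refine (hg.dist_le_mul y x).trans (mul_le_of_le_one_right K.coe_nonneg ?_)
        exact (Metric.mem_ball.1 hy).le.trans (hφ1 n)
    have h2 := hg.dist_le_mul x 0
    rw [dist_eq_norm] at h1 h2
    rw [dist_zero_right] at h2
    have h3 : ‖m n x‖ ≤ ‖m n x - g x‖ + ‖g x - g 0‖ + ‖g 0‖ := by
      have := norm_add₃_le (a := m n x - g x) (b := g x - g 0) (c := g 0)
      simpa using this
    have hK := K.coe_nonneg
    nlinarith [norm_nonneg x, norm_nonneg (g 0), mul_nonneg hK (norm_nonneg x),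
      mul_nonneg (norm_nonneg (g 0)) (norm_nonneg x)]
  let c : ℕ → E → ℝ := fun n x => χ (((n : ℝ) + 1)⁻¹ • x)
  have hc : ∀ n, ContDiff ℝ 2 (c n) := fun n =>
    χ.contDiff.comp (contDiff_const.smul contDiff_id)
  have hc0 : ∀ n x, 0 ≤ c n x := fun n x => χ.nonneg
  have hc1 : ∀ n x, c n x ≤ 1 := fun n x => χ.le_one
  obtain ⟨L, hL⟩ : ∃ L, LipschitzWith L χ :=
    (χ.contDiff (n := 1)).lipschitzWith_of_hasCompactSupport χ.hasCompactSupport one_ne_zero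
  have hcL : ∀ n, LipschitzWith L (c n) := fun n => by
    refine LipschitzWith.of_dist_le_mul fun x y => (hL.dist_le_mul _ _).trans ?_
    refine mul_le_mul_of_nonneg_left ?_ L.coe_nonneg
    rw [dist_eq_norm, ← smul_sub, norm_smul, dist_eq_norm]
    refine mul_le_of_le_one_left (norm_nonneg _) ?_
    rw [norm_inv]
    refine inv_le_one_of_one_le₀ ?_
    rw [Real.norm_of_nonneg (by positivity)]
    linarith [n.cast_nonneg (α := ℝ)]
  -- Near a fixed point the cutoff is eventually constant, so it affects neither the limit of values
  -- nor that of derivatives.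
  have hcn : ∀ x, ∀ᶠ n : ℕ in Filter.atTop, c n =ᶠ[𝓝 x] fun _ => 1 := by
    intro x
    filter_upwards [Filter.eventually_gt_atTop ⌈‖x‖⌉₊] with n hn
    have hx : ‖x‖ < (n : ℝ) + 1 := ((Nat.le_ceil _).trans (by exact_mod_cast hn.le)).trans_lt
      (lt_add_one _)
    filter_upwards [continuous_norm.continuousAt.eventually (gt_mem_nhds hx)] with y hy
    refine χ.one_of_mem_closedBall ?_
    have hn0 : (0 : ℝ) < (n : ℝ) + 1 := by positivity
    rw [mem_closedBall_zero_iff, norm_smul, norm_inv, Real.norm_of_nonneg hn0.le,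
      inv_mul_le_iff₀ hn0]
    simpa [χ] using hy.le
  have hfd : ∀ n x, fderiv ℝ (fun x => c n x • m n x) x =
      c n x • fderiv ℝ (m n) x + (fderiv ℝ (c n) x).smulRight (m n x) := fun n x =>
    fderiv_fun_smul ((hc n).differentiable two_ne_zero x) ((hm n).differentiable two_ne_zero x)
  have hCK : (0 : ℝ) ≤ 2 * K + ‖g 0‖ := by positivity
  refine ⟨fun n x => c n x • m n x, (1 + L) * (2 * K + ‖g 0‖) + K,
    fun n => (hc n).smul (hm n), fun n => ?_, by positivity, fun n x => ?_, fun n x => ?_,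
    fun x => ?_, ?_⟩
  · refine HasCompactSupport.smul_right ?_
    have hn : ((n : ℝ) + 1)⁻¹ ≠ 0 := by positivity
    exact χ.hasCompactSupport.comp_homeomorph (Homeomorph.smulOfNeZero _ hn)
  · rw [norm_smul, Real.norm_of_nonneg (hc0 n x)]
    have h1 := hmb n x
    have h2 : c n x * ‖m n x‖ ≤ ‖m n x‖ := mul_le_of_le_one_left (norm_nonneg _) (hc1 n x)
    have h3 : (2 * K + ‖g 0‖) * (1 + ‖x‖) ≤
        ((1 + L) * (2 * K + ‖g 0‖) + K) * (1 + ‖x‖) := by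
      refine mul_le_mul_of_nonneg_right ?_ (by positivity)
      nlinarith [mul_nonneg L.coe_nonneg hCK, K.coe_nonneg]
    linarith
  · rw [hfd]
    refine (norm_add_le _ _).trans ?_
    rw [norm_smul, Real.norm_of_nonneg (hc0 n x), ContinuousLinearMap.norm_smulRight_apply]
    have h1 := hmb n x
    have h2 : c n x * ‖fderiv ℝ (m n) x‖ ≤ K :=
      (mul_le_of_le_one_left (norm_nonneg _) (hc1 n x)).trans (hmb' n x)
    have h3 : ‖fderiv ℝ (c n) x‖ * ‖m n x‖ ≤ L * ((2 * K + ‖g 0‖) * (1 + ‖x‖)) :=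
      mul_le_mul (norm_fderiv_le_of_lipschitz ℝ (hcL n)) h1 (norm_nonneg _) L.coe_nonneg
    nlinarith [norm_nonneg x, mul_nonneg hCK (norm_nonneg x), K.coe_nonneg,
      mul_nonneg K.coe_nonneg (norm_nonneg x)]
  · have h1 : Filter.Tendsto (fun n => m n x) Filter.atTop (𝓝 (g x)) :=
      ContDiffBump.convolution_tendsto_right_of_continuous hφ0 hgc x
    refine h1.congr' ?_
    filter_upwards [hcn x] with n hn
    rw [hn.eq_of_nhds, one_smul]
  · have hloc : LocallyIntegrable (fderiv ℝ g) (volume : Measure E) := by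
      refine (MeasureTheory.locallyIntegrable_const (K : ℝ)).mono
        (measurable_fderiv ℝ g).aestronglyMeasurable (Filter.Eventually.of_forall fun x => ?_)
      rw [Real.norm_of_nonneg K.coe_nonneg]
      exact hgb x
    have h1 := ContDiffBump.ae_convolution_tendsto_right_of_locallyIntegrable (K := 2) hφ0
      (Filter.Eventually.of_forall fun n => by
        simp only [φ]; apply le_of_eq; field_simp) hloc
    filter_upwards [h1] with x hx
    refine hx.congr' ?_
    filter_upwards [hcn x] with n hn
    rw [hfd, hn.eq_of_nhds, hn.fderiv_eq, (hm' n x).fderiv]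
    simp

end Approximation

/-! ### Limits of compositions and evaluations of operators. -/

section OperatorLimits

variable {E F G : Type*} [NormedAddCommGroup E] [NormedSpace ℝ E] [NormedAddCommGroup F]
  [NormedSpace ℝ F] [NormedAddCommGroup G] [NormedSpace ℝ G] {ι : Type*} {l : Filter ι}

lemma tendsto_clm_comp {S : ι → F →L[ℝ] G} {T : ι → E →L[ℝ] F} {s : F →L[ℝ] G} {t : E →L[ℝ] F}
    (hS : Filter.Tendsto S l (𝓝 s)) (hT : Filter.Tendsto T l (𝓝 t)) :
    Filter.Tendsto (fun i => (S i).comp (T i)) l (𝓝 (s.comp t)) := by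
  have hc : Continuous fun q : (F →L[ℝ] G) × (E →L[ℝ] F) => q.1.comp q.2 := by fun_prop
  exact (hc.tendsto (s, t)).comp (hS.prodMk_nhds hT)

lemma tendsto_clm_apply {T : ι → E →L[ℝ] F} {X : ι → E} {t : E →L[ℝ] F} {x : E}
    (hT : Filter.Tendsto T l (𝓝 t)) (hX : Filter.Tendsto X l (𝓝 x)) :
    Filter.Tendsto (fun i => T i (X i)) l (𝓝 (t x)) := by
  have hc : Continuous fun q : (E →L[ℝ] F) × E => q.1 q.2 := by fun_prop
  exact (hc.tendsto (t, x)).comp (hT.prodMk_nhds hX)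

end OperatorLimits

/-! ### Passage from smooth fields to Lipschitz fields by dominated convergence. -/

section Limits

variable {d : ℕ}

local notation "E" => EuclideanSpace ℝ (Fin d)
local notation "γ" => stdGaussian (EuclideanSpace ℝ (Fin d))

lemma IsSmoothApprox.mono {g : E → E} {G : ℕ → E → E} {C C' : ℝ} (h : IsSmoothApprox g G C)
    (hC : C ≤ C') : IsSmoothApprox g G C' where
  contDiff := h.contDiff
  hasCompactSupport := h.hasCompactSupport
  nonneg := h.nonneg.trans hC
  norm_le n x := (h.norm_le n x).trans (by gcongr)
  norm_fderiv_le n x := (h.norm_fderiv_le n x).trans (by gcongr)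
  tendsto := h.tendsto
  tendsto_fderiv := h.tendsto_fderiv

/-- The trace of a linear endomorphism. -/
noncomputable def coordTrace (T : E →L[ℝ] E) : ℝ := ∑ i, T (EuclideanSpace.single i 1) i

/-- The pointwise value of `‖v‖² + 2 δ h`, in terms of the values of `v`, `h` and `Dh`. -/
noncomputable def steinValue (x v h : E) (H : E →L[ℝ] E) : ℝ :=
  ‖v‖ ^ 2 + 2 * (⟪x, h⟫ - coordTrace H)

/-- The integrand of the variance bound for `‖v‖² + 2 δ h`. -/
noncomputable def varianceBound (v h : E) (J H : E →L[ℝ] E) : ℝ :=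
  4 * ‖(innerSL ℝ v).comp J‖ ^ 2 + 8 * ⟪v, J h⟫ + 4 * ‖h‖ ^ 2 + 4 * traceSq H

lemma abs_apply_single_le (T : E →L[ℝ] E) (i : Fin d) :
    |T (EuclideanSpace.single i 1) i| ≤ ‖T‖ := by
  refine (PiLp.norm_apply_le (T (EuclideanSpace.single i 1)) i).trans ?_
  simpa using T.le_opNorm (EuclideanSpace.single i 1)

lemma abs_coordTrace_le (T : E →L[ℝ] E) : |coordTrace T| ≤ d * ‖T‖ := by
  refine (Finset.abs_sum_le_sum_abs _ _).trans ?_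
  refine (Finset.sum_le_sum fun i _ => abs_apply_single_le T i).trans ?_
  simp

lemma abs_traceSq_le (T : E →L[ℝ] E) : |traceSq T| ≤ d * ‖T‖ ^ 2 := by
  have h : traceSq T = coordTrace (T.comp T) := rfl
  rw [h, sq]
  refine (abs_coordTrace_le _).trans ?_
  gcongr
  exact T.opNorm_comp_le T

/-- Used with t = C(1 + ‖x‖), which bounds the approximants and their limit alike; Gaussian moments
then make the bound integrable. The same holds for `abs_varianceBound_le`. -/
lemma abs_steinValue_le {x v h : E} {H : E →L[ℝ] E} {t : ℝ} (ht : 1 ≤ t) (hx : ‖x‖ ≤ t)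
    (hv : ‖v‖ ≤ t) (hh : ‖h‖ ≤ t) (hH : ‖H‖ ≤ t) :
    |steinValue x v h H| ≤ (3 + 2 * d) * t ^ 2 := by
  have h1 : ‖v‖ ^ 2 ≤ t ^ 2 := by gcongr
  have h2 : |⟪x, h⟫| ≤ t ^ 2 := (abs_real_inner_le_norm x h).trans (by
    rw [sq]; exact mul_le_mul hx hh (norm_nonneg _) (by positivity))
  have h3 : |coordTrace H| ≤ d * t ^ 2 := (abs_coordTrace_le H).trans (by
    refine mul_le_mul_of_nonneg_left ?_ d.cast_nonneg
    nlinarith)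
  unfold steinValue
  rw [abs_le] at *
  constructor <;> nlinarith [sq_nonneg ‖v‖]

lemma abs_varianceBound_le {v h : E} {J H : E →L[ℝ] E} {t : ℝ} (ht : 1 ≤ t)
    (hv : ‖v‖ ≤ t) (hh : ‖h‖ ≤ t) (hJ : ‖J‖ ≤ t) (hH : ‖H‖ ≤ t) :
    |varianceBound v h J H| ≤ (16 + 4 * d) * t ^ 4 := by
  have t0 : 0 ≤ t := by linarith
  have t24 : t ^ 2 ≤ t ^ 4 := pow_le_pow_right₀ ht (by norm_num)
  have t34 : t ^ 3 ≤ t ^ 4 := pow_le_pow_right₀ ht (by norm_num)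
  have h1 : ‖(innerSL ℝ v).comp J‖ ≤ t ^ 2 := by
    refine (ContinuousLinearMap.opNorm_comp_le _ _).trans ?_
    rw [innerSL_apply_norm, sq]
    exact mul_le_mul hv hJ (norm_nonneg _) t0
  have h1' : ‖(innerSL ℝ v).comp J‖ ^ 2 ≤ t ^ 4 := by
    calc _ ≤ (t ^ 2) ^ 2 := by gcongr
      _ = t ^ 4 := by ring
  have h2 : |⟪v, J h⟫| ≤ t ^ 4 := by
    refine (abs_real_inner_le_norm v (J h)).trans ?_
    calc ‖v‖ * ‖J h‖ ≤ t * (t * t) := by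
          refine mul_le_mul hv ?_ (norm_nonneg _) t0
          exact (J.le_opNorm h).trans (mul_le_mul hJ hh (norm_nonneg _) t0)
      _ = t ^ 3 := by ring
      _ ≤ t ^ 4 := t34
  have h3 : ‖h‖ ^ 2 ≤ t ^ 4 := le_trans (by gcongr) t24
  have h4 : |traceSq H| ≤ d * t ^ 4 := (abs_traceSq_le H).trans (by
    refine mul_le_mul_of_nonneg_left ?_ d.cast_nonneg
    exact le_trans (by gcongr) t24)
  unfold varianceBound
  rw [abs_le] at *
  constructor <;> nlinarith [sq_nonneg ‖h‖, sq_nonneg ‖(innerSL ℝ v).comp J‖]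

lemma continuous_coordTrace : Continuous (coordTrace (d := d)) := by
  unfold coordTrace; fun_prop

lemma continuous_traceSq : Continuous (traceSq (d := d)) := by
  have h : traceSq (d := d) = fun T => coordTrace (T.comp T) := rfl
  rw [h]
  exact continuous_coordTrace.comp (continuous_id.clm_comp continuous_id)

lemma continuous_steinValue :
    Continuous fun q : E × E × E × (E →L[ℝ] E) => steinValue q.1 q.2.1 q.2.2.1 q.2.2.2 := by
  have := continuous_coordTrace (d := d)
  unfold steinValue
  fun_prop

lemma continuous_varianceBound :
    Continuous fun q : E × E × (E →L[ℝ] E) × (E →L[ℝ] E) =>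
      varianceBound q.1 q.2.1 q.2.2.1 q.2.2.2 := by
  have := continuous_traceSq (d := d)
  unfold varianceBound
  fun_prop

lemma tendsto_steinValue {x v h : E} {T : E →L[ℝ] E} {V H : ℕ → E} {S : ℕ → E →L[ℝ] E}
    (hV : Filter.Tendsto V Filter.atTop (𝓝 v)) (hH : Filter.Tendsto H Filter.atTop (𝓝 h))
    (hS : Filter.Tendsto S Filter.atTop (𝓝 T)) :
    Filter.Tendsto (fun n => steinValue x (V n) (H n) (S n)) Filter.atTop
      (𝓝 (steinValue x v h T)) :=
  (hV.norm.pow 2).add (((tendsto_const_nhds.inner hH).sub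
    ((continuous_coordTrace.tendsto T).comp hS)).const_mul 2)

lemma tendsto_varianceBound {v h : E} {T T' : E →L[ℝ] E} {V H : ℕ → E} {S S' : ℕ → E →L[ℝ] E}
    (hV : Filter.Tendsto V Filter.atTop (𝓝 v)) (hH : Filter.Tendsto H Filter.atTop (𝓝 h))
    (hS : Filter.Tendsto S Filter.atTop (𝓝 T)) (hS' : Filter.Tendsto S' Filter.atTop (𝓝 T')) :
    Filter.Tendsto (fun n => varianceBound (V n) (H n) (S n) (S' n)) Filter.atTop
      (𝓝 (varianceBound v h T T')) := by
  have h1 : Filter.Tendsto (fun n => (innerSL ℝ (V n)).comp (S n)) Filter.atTop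
      (𝓝 ((innerSL ℝ v).comp T)) := by
    exact tendsto_clm_comp (((innerSL ℝ).continuous.tendsto v).comp hV) hS
  have h2 : Filter.Tendsto (fun n => S n (H n)) Filter.atTop (𝓝 (T h)) := tendsto_clm_apply hS hH
  exact ((((h1.norm.pow 2).const_mul 4).add ((hV.inner h2).const_mul 8)).add
    ((hH.norm.pow 2).const_mul 4)).add (((continuous_traceSq.tendsto T').comp hS').const_mul 4)

/-- The standardized version of Stein's risk estimate, see `steinValue`. -/
noncomputable def steinFunction (v h : E → E) (x : E) : ℝ :=
  steinValue x (v x) (h x) (fderiv ℝ h x)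

/-- The integrand of the variance bound, see `varianceBound`. -/
noncomputable def varianceFunction (v h : E → E) (x : E) : ℝ :=
  varianceBound (v x) (h x) (fderiv ℝ v x) (fderiv ℝ h x)

lemma gaussianDivergence_eq (h : E → E) (x : E) :
    gaussianDivergence h x = ⟪x, h x⟫ - coordTrace (fderiv ℝ h x) := rfl

lemma measurable_steinFunction {v h : E → E} (hv : Continuous v) (hh : Continuous h) :
    Measurable (steinFunction v h) :=
  (continuous_steinValue.comp_stronglyMeasurable (stronglyMeasurable_id.prodMk
    (hv.stronglyMeasurable.prodMk (hh.stronglyMeasurable.prodMk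
      (measurable_fderiv ℝ h).stronglyMeasurable)))).measurable

lemma measurable_varianceFunction {v h : E → E} (hv : Continuous v) (hh : Continuous h) :
    Measurable (varianceFunction v h) :=
  (continuous_varianceBound.comp_stronglyMeasurable (hv.stronglyMeasurable.prodMk
    (hh.stronglyMeasurable.prodMk ((measurable_fderiv ℝ v).stronglyMeasurable.prodMk
      (measurable_fderiv ℝ h).stronglyMeasurable)))).measurable

lemma measurable_gaussianDivergence {h : E → E} (hh : Continuous h) :
    Measurable (gaussianDivergence h) :=
  (continuous_id.inner hh).measurable.sub
    (continuous_coordTrace.measurable.comp (measurable_fderiv ℝ h))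

lemma steinFunction_eq (v h : E → E) (x : E) :
    steinFunction v h x = ‖v x‖ ^ 2 + 2 * gaussianDivergence h x := rfl

lemma fderiv_norm_sq_eq {v : E → E} {x : E} (hv : DifferentiableAt ℝ v x) :
    fderiv ℝ (fun x => ‖v x‖ ^ 2) x = (2 : ℝ) • (innerSL ℝ (v x)).comp (fderiv ℝ v x) := by
  rw [hv.hasFDerivAt.norm_sq.fderiv]
  ext a
  simp

lemma varianceFunction_eq {v h : E → E} {x : E} (hv : DifferentiableAt ℝ v x) :
    varianceFunction v h x = ‖fderiv ℝ (fun x => ‖v x‖ ^ 2) x‖ ^ 2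
      + 4 * fderiv ℝ (fun x => ‖v x‖ ^ 2) x (h x) + 4 * ‖h x‖ ^ 2
      + 4 * traceSq (fderiv ℝ h x) := by
  rw [fderiv_norm_sq_eq hv, norm_smul, varianceFunction, varianceBound]
  simp
  ring

/-- `1 ≤ C` makes C(1 + ‖x‖) dominate both 1 and ‖x‖. -/
lemma exists_common_approx {v h : E → E} {K L : NNReal} (hv : LipschitzWith K v)
    (hh : LipschitzWith L h) : ∃ V H C, 1 ≤ C ∧ IsSmoothApprox v V C ∧ IsSmoothApprox h H C := by
  obtain ⟨V, C₁, hV⟩ := exists_isSmoothApprox hv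
  obtain ⟨H, C₂, hH⟩ := exists_isSmoothApprox hh
  exact ⟨V, H, max 1 (max C₁ C₂), le_max_left _ _,
    hV.mono ((le_max_left _ _).trans (le_max_right _ _)),
    hH.mono ((le_max_right _ _).trans (le_max_right _ _))⟩

lemma one_le_mul_one_add_norm {C : ℝ} (hC : 1 ≤ C) (x : E) :
    1 ≤ C * (1 + ‖x‖) ∧ ‖x‖ ≤ C * (1 + ‖x‖) := by
  constructor <;> nlinarith [norm_nonneg x]

lemma integrable_const_mul_growth (A C : ℝ) (n : ℕ) :
    Integrable (fun x : E => A * (C * (1 + ‖x‖)) ^ n) γ := by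
  simp only [mul_pow]
  exact ((integrable_one_add_norm_pow_stdGaussian n).const_mul _).const_mul _

lemma IsSmoothApprox.norm_limit_le {g : E → E} {G : ℕ → E → E} {C : ℝ}
    (h : IsSmoothApprox g G C) (x : E) : ‖g x‖ ≤ C * (1 + ‖x‖) :=
  le_of_tendsto (h.tendsto x).norm (Filter.Eventually.of_forall fun n => h.norm_le n x)

lemma IsSmoothApprox.norm_fderiv_limit_le {g : E → E} {G : ℕ → E → E} {C : ℝ}
    (h : IsSmoothApprox g G C) : ∀ᵐ x, ‖fderiv ℝ g x‖ ≤ C * (1 + ‖x‖) := by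
  filter_upwards [h.tendsto_fderiv] with x hx
  exact le_of_tendsto hx.norm (Filter.Eventually.of_forall fun n => h.norm_fderiv_le n x)

lemma memLp_steinFunction {v h : E → E} {K L : NNReal} (hv : LipschitzWith K v)
    (hh : LipschitzWith L h) : MemLp (steinFunction v h) 2 γ := by
  obtain ⟨V, H, C, hC, hV, hH⟩ := exists_common_approx hv hh
  rw [memLp_two_iff_integrable_sq
    (measurable_steinFunction hv.continuous hh.continuous).aestronglyMeasurable]
  refine (integrable_const_mul_growth ((3 + 2 * d) ^ 2) C 4).mono'
    ((measurable_steinFunction hv.continuous hh.continuous).pow_const 2).aestronglyMeasurable ?_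
  filter_upwards [stdGaussian_absolutelyContinuous.ae_le hH.norm_fderiv_limit_le] with x hx
  have h1 := abs_steinValue_le (one_le_mul_one_add_norm hC x).1 (one_le_mul_one_add_norm hC x).2
    (hV.norm_limit_le x) (hH.norm_limit_le x) hx
  calc ‖steinFunction v h x ^ 2‖ = |steinValue x (v x) (h x) (fderiv ℝ h x)| ^ 2 := by
        rw [norm_pow]; rfl
    _ ≤ ((3 + 2 * d) * (C * (1 + ‖x‖)) ^ 2) ^ 2 := by gcongr
    _ = _ := by ring

lemma integrable_varianceFunction {v h : E → E} {K L : NNReal} (hv : LipschitzWith K v)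
    (hh : LipschitzWith L h) : Integrable (varianceFunction v h) γ := by
  obtain ⟨V, H, C, hC, hV, hH⟩ := exists_common_approx hv hh
  refine (integrable_const_mul_growth (16 + 4 * d) C 4).mono'
    (measurable_varianceFunction hv.continuous hh.continuous).aestronglyMeasurable ?_
  filter_upwards [stdGaussian_absolutelyContinuous.ae_le hV.norm_fderiv_limit_le,
    stdGaussian_absolutelyContinuous.ae_le hH.norm_fderiv_limit_le] with x hx hx'
  exact abs_varianceBound_le (one_le_mul_one_add_norm hC x).1
    (hV.norm_limit_le x) (hH.norm_limit_le x) hx hx'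

/-- The variance bound for Lipschitz fields. -/
theorem variance_steinFunction_le {v h : E → E} {K L : NNReal} (hv : LipschitzWith K v)
    (hh : LipschitzWith L h) :
    Var[steinFunction v h; γ] ≤ ∫ x, varianceFunction v h x ∂γ := by
  obtain ⟨V, H, C, hC, hV, hH⟩ := exists_common_approx hv hh
  have hac := (stdGaussian_absolutelyContinuous : γ ≪ volume)
  have hS : ∀ᵐ x ∂γ, Filter.Tendsto (fun n => steinFunction (V n) (H n) x) Filter.atTop
      (𝓝 (steinFunction v h x)) := by
    filter_upwards [hac.ae_le hH.tendsto_fderiv] with x hx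
    exact tendsto_steinValue (hV.tendsto x) (hH.tendsto x) hx
  have hb : ∀ n x, |steinFunction (V n) (H n) x| ≤ (3 + 2 * d) * (C * (1 + ‖x‖)) ^ 2 := fun n x =>
    abs_steinValue_le (one_le_mul_one_add_norm hC x).1 (one_le_mul_one_add_norm hC x).2
      (hV.norm_le n x) (hH.norm_le n x) (hH.norm_fderiv_le n x)
  have hmeas : ∀ n, Measurable (steinFunction (V n) (H n)) := fun n =>
    measurable_steinFunction (hV.contDiff n).continuous (hH.contDiff n).continuous
  have lim1 : Filter.Tendsto (fun n => ∫ x, steinFunction (V n) (H n) x ∂γ) Filter.atTop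
      (𝓝 (∫ x, steinFunction v h x ∂γ)) :=
    tendsto_integral_of_dominated_convergence _ (fun n => (hmeas n).aestronglyMeasurable)
      (integrable_const_mul_growth (3 + 2 * d) C 2)
      (fun n => Filter.Eventually.of_forall (hb n)) hS
  have lim2 : Filter.Tendsto (fun n => ∫ x, steinFunction (V n) (H n) x ^ 2 ∂γ) Filter.atTop
      (𝓝 (∫ x, steinFunction v h x ^ 2 ∂γ)) := by
    refine tendsto_integral_of_dominated_convergence _
      (fun n => ((hmeas n).pow_const 2).aestronglyMeasurable)
      (integrable_const_mul_growth ((3 + 2 * d) ^ 2) C 4)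
      (fun n => Filter.Eventually.of_forall fun x => ?_) (hS.mono fun x hx => hx.pow 2)
    rw [norm_pow, Real.norm_eq_abs]
    calc _ ≤ ((3 + 2 * d) * (C * (1 + ‖x‖)) ^ 2) ^ 2 := by gcongr; exact hb n x
      _ = _ := by ring
  have lim3 : Filter.Tendsto (fun n => ∫ x, varianceFunction (V n) (H n) x ∂γ) Filter.atTop
      (𝓝 (∫ x, varianceFunction v h x ∂γ)) := by
    refine tendsto_integral_of_dominated_convergence _
      (fun n => (measurable_varianceFunction (hV.contDiff n).continuous
        (hH.contDiff n).continuous).aestronglyMeasurable)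
      (integrable_const_mul_growth (16 + 4 * d) C 4)
      (fun n => Filter.Eventually.of_forall fun x =>
        abs_varianceBound_le (one_le_mul_one_add_norm hC x).1 (hV.norm_le n x) (hH.norm_le n x)
          (hV.norm_fderiv_le n x) (hH.norm_fderiv_le n x)) ?_
    filter_upwards [hac.ae_le hV.tendsto_fderiv, hac.ae_le hH.tendsto_fderiv] with x hx hx'
    exact tendsto_varianceBound (hV.tendsto x) (hH.tendsto x) hx hx'
  rw [variance_eq_sub (memLp_steinFunction hv hh)]
  refine le_of_tendsto_of_tendsto' (lim2.sub (lim1.pow 2)) lim3 fun n => ?_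
  have hV1 : ContDiff ℝ 1 (V n) := (hV.contDiff n).of_le (by norm_num)
  have huc : HasCompactSupport fun x => ‖V n x‖ ^ 2 :=
    HasCompactSupport.intro (hV.hasCompactSupport n) fun x hx => by
      simp [image_eq_zero_of_notMem_tsupport hx]
  have := variance_add_gaussianDivergence_le (hV1.norm_sq ℝ) huc (hH.contDiff n)
    (hH.hasCompactSupport n)
  simpa only [steinFunction_eq, varianceFunction_eq (hV1.differentiable one_ne_zero _)] using this

lemma integrable_divergence {v : E → E} {K : NNReal} (hv : LipschitzWith K v) :
    Integrable (divergence v) γ := by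
  refine Integrable.of_bound (C := d * K)
    (continuous_coordTrace.measurable.comp (measurable_fderiv ℝ v)).aestronglyMeasurable
    (Filter.Eventually.of_forall fun x => (abs_coordTrace_le (fderiv ℝ v x)).trans ?_)
  gcongr
  exact norm_fderiv_le_of_lipschitz ℝ hv

lemma integrable_inner_lipschitz {v : E → E} {K : NNReal} (hv : LipschitzWith K v) :
    Integrable (fun x => ⟪x, v x⟫) γ := by
  obtain ⟨V, C, hV⟩ := exists_isSmoothApprox hv
  have hc := hv.continuous
  refine (integrable_const_mul_growth C 1 2).mono'
    (by fun_prop : Continuous _).aestronglyMeasurable (Filter.Eventually.of_forall fun x => ?_)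
  refine (abs_real_inner_le_norm _ _).trans ?_
  have h1 := hV.norm_limit_le x
  have h2 := norm_nonneg x
  nlinarith [hV.nonneg, mul_le_mul_of_nonneg_left h1 h2, mul_nonneg hV.nonneg h2]

lemma integrable_norm_sq_lipschitz {v : E → E} {K : NNReal} (hv : LipschitzWith K v) :
    Integrable (fun x => ‖v x‖ ^ 2) γ := by
  obtain ⟨V, C, hV⟩ := exists_isSmoothApprox hv
  have hc := hv.continuous
  refine (integrable_const_mul_growth 1 C 2).mono'
    (by fun_prop : Continuous _).aestronglyMeasurable (Filter.Eventually.of_forall fun x => ?_)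
  rw [norm_pow, norm_norm, one_mul]
  gcongr
  exact hV.norm_limit_le x

/-- Stein's identity for Lipschitz fields. -/
theorem integral_inner_lipschitz {v : E → E} {K : NNReal} (hv : LipschitzWith K v) :
    ∫ x, ⟪x, v x⟫ ∂γ = ∫ x, divergence v x ∂γ := by
  obtain ⟨V, -, C, hC, hV, -⟩ := exists_common_approx hv hv
  have hlim : Filter.Tendsto (fun n => ∫ x, gaussianDivergence (V n) x ∂γ) Filter.atTop
      (𝓝 (∫ x, gaussianDivergence v x ∂γ)) := by
    refine tendsto_integral_of_dominated_convergence _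
      (fun n => (measurable_gaussianDivergence (hV.contDiff n).continuous).aestronglyMeasurable)
      (integrable_const_mul_growth (3 + 2 * d) C 2)
      (fun n => Filter.Eventually.of_forall fun x => ?_) ?_
    · have ht := one_le_mul_one_add_norm hC x
      -- With `v := 0`, `steinValue` is twice the Gaussian divergence.
      have h := abs_steinValue_le (v := 0) ht.1 ht.2 (by simpa using zero_le_one.trans ht.1)
        (hV.norm_le n x) (hV.norm_fderiv_le n x)
      rw [steinValue, ← gaussianDivergence_eq, norm_zero, zero_pow two_ne_zero, zero_add, abs_mul,
        abs_two] at h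
      rw [Real.norm_eq_abs]
      linarith [abs_nonneg (gaussianDivergence (V n) x)]
    · filter_upwards [stdGaussian_absolutelyContinuous.ae_le hV.tendsto_fderiv] with x hx
      exact (tendsto_const_nhds.inner (hV.tendsto x)).sub
        ((continuous_coordTrace.tendsto _).comp hx)
  have h0 : ∀ n, ∫ x, gaussianDivergence (V n) x ∂γ = 0 := fun n =>
    integral_gaussianDivergence ((hV.contDiff n).of_le (by norm_num)) (hV.hasCompactSupport n)
  simp only [h0] at hlim
  have h1 := tendsto_nhds_unique hlim tendsto_const_nhds
  unfold gaussianDivergence at h1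
  rw [integral_sub (integrable_inner_lipschitz hv) (integrable_divergence hv)] at h1
  linarith

end Limits

/-! ### The variance bound for unit noise and mean zero. -/

section Standardized

variable {d : ℕ}

local notation "E" => EuclideanSpace ℝ (Fin d)
local notation "γ" => stdGaussian (EuclideanSpace ℝ (Fin d))

lemma inner_single_one_right (x : E) (i : Fin d) :
    ⟪x, EuclideanSpace.single i (1 : ℝ)⟫ = x i := by
  simp [PiLp.inner_apply]

lemma divergence_eq_coordTrace (h : E → E) (x : E) :
    divergence h x = coordTrace (fderiv ℝ h x) := rfl

/-- By symmetry the diagonal entries of J² are ‖J e_i‖². -/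
lemma traceSq_le_coordTrace {J : E →L[ℝ] E} (hs : ∀ a b, ⟪J a, b⟫ = ⟪a, J b⟫)
    (hf : ∀ a, ‖J a‖ ^ 2 ≤ ⟪J a, a⟫) : traceSq J ≤ coordTrace J := by
  refine Finset.sum_le_sum fun i _ => ?_
  rw [← inner_single_one_right, ← inner_single_one_right, hs, real_inner_self_eq_norm_sq]
  exact hf _

lemma coordTrace_half_sub (J : E →L[ℝ] E) :
    coordTrace ((1 / 2 : ℝ) • ContinuousLinearMap.id ℝ E - J) = d / 2 - coordTrace J := by
  simp [coordTrace, Finset.sum_sub_distrib, div_eq_mul_inv]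

lemma traceSq_half_sub (J : E →L[ℝ] E) :
    traceSq ((1 / 2 : ℝ) • ContinuousLinearMap.id ℝ E - J) =
      d / 4 - coordTrace J + traceSq J := by
  have h : ∀ i : Fin d, ((1 / 2 : ℝ) • ContinuousLinearMap.id ℝ E - J)
      (((1 / 2 : ℝ) • ContinuousLinearMap.id ℝ E - J) (EuclideanSpace.single i 1)) i =
      1 / 4 - J (EuclideanSpace.single i 1) i + J (J (EuclideanSpace.single i 1)) i := by
    intro i
    simp
    ring
  simp only [traceSq, coordTrace, h, Finset.sum_add_distrib, Finset.sum_sub_distrib]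
  simp [div_eq_mul_inv]

/-- The field whose Gaussian divergence gives the fluctuation of Stein's risk estimate. -/
noncomputable def steinField (v : E → E) (x : E) : E := (1 / 2 : ℝ) • x - v x

lemma fderiv_steinField {v : E → E} {x : E} (hd : DifferentiableAt ℝ v x) :
    fderiv ℝ (steinField v) x = (1 / 2 : ℝ) • ContinuousLinearMap.id ℝ E - fderiv ℝ v x :=
  (((hasFDerivAt_id x).const_smul (1 / 2 : ℝ)).sub hd.hasFDerivAt).fderiv

lemma lipschitzWith_steinField {v : E → E} {K : NNReal} (hv : LipschitzWith K v) :
    LipschitzWith (‖(1 / 2 : ℝ)‖₊ + K) (steinField v) :=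
  (lipschitzWith_smul (1 / 2 : ℝ)).sub hv

/-- ‖v - x‖² = ‖v‖² + 2⟪x, x/2 - v⟫, and the divergence d/2 of x/2 accounts for the term -d. -/
lemma steinFunction_steinField {v : E → E} {x : E} (hd : DifferentiableAt ℝ v x) :
    steinFunction v (steinField v) x = -(d : ℝ) + ‖v x - x‖ ^ 2 + 2 * divergence v x := by
  rw [steinFunction, steinValue, fderiv_steinField hd, coordTrace_half_sub,
    divergence_eq_coordTrace, steinField, inner_sub_right, real_inner_smul_right,
    real_inner_self_eq_norm_sq, norm_sub_sq_real, real_inner_comm]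
  ring

/-- The terms in Jv are 4‖Jv‖² + 4⟪Jv, x⟫ - 8⟪Jv, v⟫. Since ‖Jv‖² ≤ ⟪Jv, v⟫, they are at most 4⟪Jv,
x⟫ - 4‖Jv‖² ≤ ‖x‖², by completing the square. Since tr J² ≤ tr J, the trace term is at most d. -/
lemma varianceFunction_steinField_le {v : E → E} {ρ : E → ℝ} (hp : IsProxWith v ρ) {x : E}
    (hd : DifferentiableAt ℝ v x) :
    varianceFunction v (steinField v) x ≤
      2 * ‖x‖ ^ 2 - 4 * ⟪x, v x⟫ + 4 * ‖v x‖ ^ 2 + d := by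
  rw [varianceFunction, varianceBound, fderiv_steinField hd, traceSq_half_sub]
  set J := fderiv ℝ v x
  have hs : ∀ a b, ⟪J a, b⟫ = ⟪a, J b⟫ := hp.fderiv_symm hd
  have hf : ∀ a, ‖J a‖ ^ 2 ≤ ⟪J a, a⟫ := hp.fderiv_norm_sq_le hd
  have e1 : (innerSL ℝ (v x)).comp J = innerSL ℝ (J (v x)) := by
    ext a
    simp [hs]
  have e2 : ⟪v x, J (steinField v x)⟫ = 1 / 2 * ⟪J (v x), x⟫ - ⟪J (v x), v x⟫ := by
    rw [← hs, steinField, inner_sub_right, real_inner_smul_right]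
  have e3 : ‖steinField v x‖ ^ 2 = 1 / 4 * ‖x‖ ^ 2 - ⟪x, v x⟫ + ‖v x‖ ^ 2 := by
    rw [steinField, norm_sub_sq_real, norm_smul, real_inner_smul_left, mul_pow, Real.norm_eq_abs,
      sq_abs]
    ring
  have h1 := hf (v x)
  have h2 := traceSq_le_coordTrace hs hf
  have h3 : 0 ≤ ‖(2 : ℝ) • J (v x) - x‖ ^ 2 := by positivity
  rw [norm_sub_sq_real, norm_smul, mul_pow, real_inner_smul_left, Real.norm_eq_abs, sq_abs] at h3
  rw [e1, e2, e3, innerSL_apply_norm]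
  linarith

/-- Stein's identity for the identity field, whose divergence is `d`. -/
lemma integral_norm_sq_stdGaussian : ∫ x, ‖x‖ ^ 2 ∂γ = d := by
  have h := integral_inner_lipschitz (LipschitzWith.id (α := EuclideanSpace ℝ (Fin d)))
  have h1 : ∀ x : E, divergence id x = d := fun x => by simp [divergence]
  simpa [h1, real_inner_self_eq_norm_sq] using h

/-- The variance bound for Stein's risk estimate of a proximal map, unit noise and mean zero. -/
theorem variance_steinFunction_steinField_le {v : E → E} {ρ : E → ℝ} (hp : IsProxWith v ρ) :
    Var[steinFunction v (steinField v); γ] ≤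
      3 * d - 4 * ∫ x, divergence v x ∂γ + 4 * ∫ x, ‖v x‖ ^ 2 ∂γ := by
  have hv := hp.lipschitzWith
  have i1 : Integrable (fun x : E => ‖x‖ ^ 2) γ := integrable_norm_pow_stdGaussian 2
  have i2 := integrable_inner_lipschitz hv
  have i3 := integrable_norm_sq_lipschitz hv
  have i12 : Integrable (fun x => 2 * ‖x‖ ^ 2 - 4 * ⟪x, v x⟫) γ :=
    (i1.const_mul 2).sub (i2.const_mul 4)
  refine (variance_steinFunction_le hv (lipschitzWith_steinField hv)).trans ?_
  calc ∫ x, varianceFunction v (steinField v) x ∂γ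
      ≤ ∫ x, (2 * ‖x‖ ^ 2 - 4 * ⟪x, v x⟫ + 4 * ‖v x‖ ^ 2 + d) ∂γ := by
        refine integral_mono_ae (integrable_varianceFunction hv (lipschitzWith_steinField hv))
          ((i12.add (i3.const_mul 4)).add (integrable_const _)) ?_
        filter_upwards [stdGaussian_absolutelyContinuous.ae_le
          (hv.ae_differentiableAt (μ := volume))] with x hx
        exact varianceFunction_steinField_le hp hx
    _ = _ := by
        rw [integral_add (i12.fun_add (i3.const_mul 4))
            (integrable_const _),
          integral_add i12 (i3.const_mul 4),
          integral_sub (i1.const_mul 2) (i2.const_mul 4), integral_const_mul, integral_const_mul,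
          integral_const_mul, integral_norm_sq_stdGaussian, integral_inner_lipschitz hv]
        simp
        ring

lemma multivariateGaussian_smul_one (μ : E) {σ : ℝ} (hσ : 0 < σ) :
    multivariateGaussian μ (σ ^ 2 • (1 : Matrix (Fin d) (Fin d) ℝ)) =
      (γ).map fun z => μ + σ • z := by
  have hps : (σ ^ 2 • (1 : Matrix (Fin d) (Fin d) ℝ)).PosSemidef :=
    Matrix.PosSemidef.one.smul (sq_nonneg σ)
  have hT : Measurable fun z : E => μ + σ • z := by fun_prop
  have : IsProbabilityMeasure ((γ).map fun z => μ + σ • z) :=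
    Measure.isProbabilityMeasure_map hT.aemeasurable
  refine Measure.ext_of_charFun ?_
  ext t
  rw [charFun_multivariateGaussian hps, charFun_apply, integral_map hT.aemeasurable
    (by fun_prop : Continuous _).aestronglyMeasurable]
  have h := charFun_stdGaussian (σ • t)
  rw [charFun_apply] at h
  have e : ∀ z : E, Complex.exp (⟪μ + σ • z, t⟫ * Complex.I) =
      Complex.exp (⟪t, μ⟫ * Complex.I) * Complex.exp (⟪z, σ • t⟫ * Complex.I) := by
    intro z
    rw [← Complex.exp_add, inner_add_left, real_inner_smul_left, real_inner_smul_right,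
      real_inner_comm t μ]
    push_cast
    ring_nf
  simp only [e]
  rw [integral_const_mul, h, ← Complex.exp_add]
  congr 1
  have e2 : (t : Fin d → ℝ) ⬝ᵥ (σ ^ 2 • (1 : Matrix (Fin d) (Fin d) ℝ)).mulVec t =
      σ ^ 2 * ‖t‖ ^ 2 := by
    rw [Matrix.smul_mulVec, Matrix.one_mulVec, dotProduct_smul, EuclideanSpace.real_norm_sq_eq]
    simp [dotProduct, sq]
  rw [e2, norm_smul, Real.norm_of_nonneg hσ.le]
  push_cast
  ring

end Standardized

/-! ### Change of variables between the observation and standardized coordinates. -/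

section Transfer

variable {d : ℕ}

local notation "E" => EuclideanSpace ℝ (Fin d)

lemma measurable_divergence (p : E → E) : Measurable (divergence p) :=
  continuous_coordTrace.measurable.comp (measurable_fderiv ℝ p)

lemma measurable_sure (σ : ℝ) {p : E → E} (hp : Continuous p) : Measurable (sure σ p) := by
  have h := measurable_divergence p
  have h1 : Measurable fun y => ‖p y - y‖ ^ 2 := (by fun_prop : Continuous _).measurable
  unfold sure
  fun_prop

/-- The chain rule factor σ cancels σ⁻¹, so standardizing preserves the divergence. -/
lemma hasFDerivAt_standardize {p : E → E} (μ : E) {σ : ℝ} (hσ : σ ≠ 0) {z : E}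
    (hd : DifferentiableAt ℝ p (μ + σ • z)) :
    HasFDerivAt (fun z => σ⁻¹ • (p (μ + σ • z) - μ)) (fderiv ℝ p (μ + σ • z)) z := by
  have h1 : HasFDerivAt (fun z : E => μ + σ • z) (σ • ContinuousLinearMap.id ℝ E) z :=
    ((hasFDerivAt_id z).const_smul σ).const_add μ
  have h2 := ((hd.hasFDerivAt.comp z h1).sub_const μ).const_smul σ⁻¹
  refine h2.congr_fderiv ?_
  ext a
  simp [hσ]

/-- Rademacher's theorem is applied to the composite, so the exceptional set already lies in the
standardized coordinate; the inverse affine map returns differentiability to `p`. -/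
lemma ae_differentiableAt_affine {p : E → E} {K : NNReal} (hp : LipschitzWith K p) (μ : E)
    {σ : ℝ} (hσ : σ ≠ 0) :
    ∀ᵐ z ∂(stdGaussian E), DifferentiableAt ℝ p (μ + σ • z) := by
  have h1 : LipschitzWith (K * ‖σ‖₊) fun z => p (μ + σ • z) := by
    have : LipschitzWith ‖σ‖₊ fun z : E => μ + σ • z := by
      simpa using (LipschitzWith.const μ).add (lipschitzWith_smul (β := E) σ)
    exact hp.comp this
  filter_upwards [stdGaussian_absolutelyContinuous.ae_le
    (h1.ae_differentiableAt (μ := volume))] with z hz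
  have e : p = (fun z => p (μ + σ • z)) ∘ fun y => σ⁻¹ • (y - μ) := by
    ext1 y
    simp [smul_smul, hσ]
  rw [e]
  refine DifferentiableAt.comp _ ?_ (by fun_prop)
  simpa [smul_smul, hσ] using hz

end Transfer

end SureCR

/-! ### The main theorem, by transfer to the standardized problem. -/

theorem mainTheorem4 {d : ℕ} {B : Type*} [AddCommGroup B] [Module ℝ B] [FiniteDimensional ℝ B]
    (A : B →ₗ[ℝ] EuclideanSpace ℝ (Fin d)) (r : B → EReal) (hr : SureCR.IsProperConvex r)
    (muHat : EuclideanSpace ℝ (Fin d) → EuclideanSpace ℝ (Fin d))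
    (hmuHat : SureCR.IsRegularizedRegression A r muHat)
    (μ : EuclideanSpace ℝ (Fin d)) (σ : ℝ) (hσ : 0 < σ)
    {Ω : Type*} [MeasurableSpace Ω] (P : Measure Ω) [IsProbabilityMeasure P]
    (y : Ω → EuclideanSpace ℝ (Fin d))
    (hy : HasLaw y (multivariateGaussian μ (σ ^ 2 • (1 : Matrix (Fin d) (Fin d) ℝ))) P) :
    -- almost surely `muHat` is differentiable at `y`, with positive semidefinite derivative
    -- and nonnegative divergence
    (∀ᵐ ω ∂P, DifferentiableAt ℝ muHat (y ω) ∧ (fderiv ℝ muHat (y ω)).IsPositive ∧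
      0 ≤ SureCR.divergence muHat (y ω)) ∧
    -- the risk, the expected divergence and the variance of SURE are finite
    Integrable (fun ω => ‖muHat (y ω) - μ‖ ^ 2) P ∧
    Integrable (fun ω => SureCR.divergence muHat (y ω)) P ∧
    MemLp (fun ω => SureCR.sure σ muHat (y ω)) 2 P ∧
    -- the variance bound with the divergence term, and the variance bound
    Var[fun ω => SureCR.sure σ muHat (y ω); P] ≤
      3 * σ ^ 4 * d - 4 * σ ^ 4 * (∫ ω, SureCR.divergence muHat (y ω) ∂P)
        + 4 * σ ^ 2 * SureCR.risk P y μ muHat ∧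
    Var[fun ω => SureCR.sure σ muHat (y ω); P] ≤
      3 * σ ^ 4 * d + 4 * σ ^ 2 * SureCR.risk P y μ muHat := by
  open SureCR in
  obtain ⟨ρ, hprox⟩ := hmuHat.exists_isProxWith hr
  have hlip := hprox.lipschitzWith
  have hcont := hlip.continuous
  have hσ0 := hσ.ne'
  set γ := stdGaussian (EuclideanSpace ℝ (Fin d)) with hγ
  set T : EuclideanSpace ℝ (Fin d) → EuclideanSpace ℝ (Fin d) := fun z => μ + σ • z with hTdef
  have hT : Measurable T := by fun_prop
  have hym : AEMeasurable y P := hy.aemeasurable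
  have hlaw : P.map y = γ.map T := by rw [hy.map_eq, multivariateGaussian_smul_one μ hσ]
  let v : EuclideanSpace ℝ (Fin d) → EuclideanSpace ℝ (Fin d) :=
    fun z => σ⁻¹ • (muHat (T z) - μ)
  have hv : IsProxWith v _ := hprox.standardize μ hσ0
  have hvlip := hv.lipschitzWith
  have hdiff : ∀ᵐ z ∂γ, DifferentiableAt ℝ muHat (T z) := ae_differentiableAt_affine hlip μ hσ0
  have hfd : ∀ᵐ z ∂γ, divergence muHat (T z) = divergence v z := by
    filter_upwards [hdiff] with z hz
    rw [divergence_eq_coordTrace, divergence_eq_coordTrace,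
      (hasFDerivAt_standardize μ hσ0 hz).fderiv]
  have hloss : ∀ z, ‖muHat (T z) - μ‖ ^ 2 = σ ^ 2 * ‖v z‖ ^ 2 := fun z => by
    simp only [v]
    rw [norm_smul, mul_pow, norm_inv, Real.norm_of_nonneg hσ.le]
    field_simp
  -- SURE scales by σ², which gives the factor σ⁴ in the variance.
  have hsure : ∀ᵐ z ∂γ, sure σ muHat (T z) = σ ^ 2 * steinFunction v (steinField v) z := by
    filter_upwards [hdiff, hfd] with z hz hz'
    have hvd : DifferentiableAt ℝ v z := (hasFDerivAt_standardize μ hσ0 hz).differentiableAt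
    have e : muHat (T z) - T z = σ • (v z - z) := by
      simp only [v, smul_sub, smul_smul, mul_inv_cancel₀ hσ0, one_smul, T]
      abel
    rw [steinFunction_steinField hvd, sure, hz', e, norm_smul, mul_pow, Real.norm_of_nonneg hσ.le]
    ring
  have msure : Measurable (sure σ muHat) := measurable_sure σ hcont
  have mdiv : Measurable (divergence muHat) := measurable_divergence muHat
  have mloss : Measurable fun y => ‖muHat y - μ‖ ^ 2 := (by fun_prop : Continuous _).measurable
  -- almost sure differentiability
  have hae : ∀ᵐ ω ∂P, DifferentiableAt ℝ muHat (y ω) ∧ (fderiv ℝ muHat (y ω)).IsPositive ∧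
      0 ≤ divergence muHat (y ω) := by
    have h1 : ∀ᵐ x ∂(P.map y), DifferentiableAt ℝ muHat x := by
      rw [hlaw, ae_map_iff hT.aemeasurable (measurableSet_of_differentiableAt ℝ muHat)]
      exact hdiff
    filter_upwards [ae_of_ae_map hym h1] with ω hω
    refine ⟨hω, hprox.fderiv_isPositive hω, Finset.sum_nonneg fun i _ => ?_⟩
    rw [← inner_single_one_right]
    exact (sq_nonneg _).trans (hprox.fderiv_norm_sq_le hω _)
  -- transfer of integrals
  have hinteg : ∀ f : EuclideanSpace ℝ (Fin d) → ℝ, Measurable f →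
      (Integrable (fun ω => f (y ω)) P ↔ Integrable (fun z => f (T z)) γ) := fun f hf => by
    have h1 := integrable_map_measure (μ := P) (f := y) (g := f) hf.aestronglyMeasurable hym
    have h2 := integrable_map_measure (μ := γ) (f := T) (g := f) hf.aestronglyMeasurable
      hT.aemeasurable
    rw [hlaw] at h1
    exact h1.symm.trans h2
  have hintegral : ∀ f : EuclideanSpace ℝ (Fin d) → ℝ, Measurable f →
      ∫ ω, f (y ω) ∂P = ∫ z, f (T z) ∂γ := fun f hf => by
    rw [← integral_map hym hf.aestronglyMeasurable, hlaw,
      integral_map hT.aemeasurable hf.aestronglyMeasurable]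
  have hdivint : ∫ ω, divergence muHat (y ω) ∂P = ∫ z, divergence v z ∂γ := by
    rw [hintegral _ mdiv, integral_congr_ae hfd]
  have hrisk : risk P y μ muHat = σ ^ 2 * ∫ z, ‖v z‖ ^ 2 ∂γ := by
    rw [risk, hintegral _ mloss]
    simp only [hloss]
    rw [integral_const_mul]
  have hmem : MemLp (fun z => sure σ muHat (T z)) 2 γ :=
    (memLp_congr_ae hsure).2
      ((memLp_steinFunction hvlip (lipschitzWith_steinField hvlip)).const_mul (σ ^ 2))
  have hvar : Var[fun ω => sure σ muHat (y ω); P] ≤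
      3 * σ ^ 4 * d - 4 * σ ^ 4 * (∫ ω, divergence muHat (y ω) ∂P)
        + 4 * σ ^ 2 * risk P y μ muHat := by
    have h1 : Var[fun ω => sure σ muHat (y ω); P] =
        Var[fun z => σ ^ 2 * steinFunction v (steinField v) z; γ] := by
      rw [← variance_congr hsure]
      have a1 := variance_map (μ := P) (X := sure σ muHat) (Y := y) msure.aemeasurable hym
      have a2 := variance_map (μ := γ) (X := sure σ muHat) (Y := T) msure.aemeasurable
        hT.aemeasurable
      rw [hlaw, a2] at a1
      exact a1.symm
    rw [h1, variance_const_mul, hdivint, hrisk]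
    have h2 := mul_le_mul_of_nonneg_left (variance_steinFunction_steinField_le hv)
      (by positivity : 0 ≤ (σ ^ 2) ^ 2)
    refine h2.trans (le_of_eq ?_)
    ring
  refine ⟨hae, ?_, ?_, ?_, hvar, hvar.trans ?_⟩
  · rw [hinteg _ mloss]
    simp only [hloss]
    exact (integrable_norm_sq_lipschitz hvlip).const_mul _
  · rw [hinteg _ mdiv, integrable_congr hfd]
    exact integrable_divergence hvlip
  · have h1 := memLp_map_measure_iff (p := 2) (μ := P) (f := y) (g := sure σ muHat)
      msure.aestronglyMeasurable hym
    have h2 := memLp_map_measure_iff (p := 2) (μ := γ) (f := T) (g := sure σ muHat)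
      msure.aestronglyMeasurable hT.aemeasurable
    rw [hlaw] at h1
    exact h1.1 (h2.2 hmem)
  · have h0 : 0 ≤ ∫ ω, divergence muHat (y ω) ∂P :=
      integral_nonneg_of_ae (hae.mono fun ω hω => hω.2.2)
    have : 0 ≤ 4 * σ ^ 4 * ∫ ω, divergence muHat (y ω) ∂P := by positivity
    linarith
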